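/- Let $\mathbb{K}$ be an algebraically closed field of characteristic zero. All varieties are normal, affine and irreducible over $\mathbb{K}$, and all actions are regular. An $SL(2)$-embedding is a three-dimensional variety $Y$ with a locally transitive (i.e. having an open orbit) and locally free $SL(2)$-action; it has height $h\in\mathbb{Q}$ if for some open equivariant embedding $\varphi: SL(2)\hookrightarrow Y$ one has $\varphi^*(\mathbb{K}[Y]^U)=\langle \alpha^i\beta^j \mid j\le hi\rangle$, where $U$ is the group of lower unitriangular matrices and $\alpha,\beta$ are the entries of the first row of a matrix in $SL(2)$. An $SL(2)/\mathbb{Z}_r$-embedding is a three-dimensional variety $X$ with a locally transitive, not transitive $SL(2)$-action for which the stabilizer of a point of the open orbit is cyclic of order $r$; it has height $h$ if $X\cong Y/\!/\mathbb{Z}_r$ $SL(2)$-equivariantly for some $SL(2)$-embedding $Y$ of height $h$, where $\mathbb{Z}_r\subset SL(2)$ acts on $Y$ by an extension of its action on $SL(2)\subset Y$ by right shifts. Let $p<q$ be coprime positive integers, let $l$ be a positive integer, and let $X$ be an $SL(2)/\mathbb{Z}_{l(q-p)}$-embedding of height $p/q$. Then $X$ is toric, and the cone corresponding to it as a toric variety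 is $$\sigma=\operatorname{cone}\bigl((1,0,0),\,(0,1,0),\,(-1,0,lq),\,(0,-1,lp)\bigr)\subset N_{\mathbb{Q}}\cong\mathbb{Q}^3 .$$ That is, there is a locally transitive action on $X$ of the torus $T=(\mathbb{K}^*)^3$, with character lattice $M=\mathbb{Z}^3$ and dual lattice $N$, such that $\mathbb{K}[X]$ is $T$-equivariantly isomorphic to the semigroup algebra $\mathbb{K}[M\cap\hat\sigma]$, where $\hat\sigma\subset M_{\mathbb{Q}}$ is the dual cone of $\sigma$, and $\sigma$ is a strongly convex polyhedral cone. -/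

import Mathlib

open scoped MatrixGroups

namespace ToricSL2

/-!
An irreducible affine variety `X` over an algebraically closed field `K` is given by its coordinate
ring `A = K[X]`, a finitely generated `K`-algebra without zero divisors. It is normal when `A` is
integrally closed. Its points are the `K`-algebra homomorphisms `A → K`, and the value of `f : A` at
the point `x` is `x f`.
-/

section Varieties

universe u v w

/-- The points of the affine variety with coordinate ring `A`. -/
abbrev Pts (K : Type u) (A : Type v) [Field K] [CommRing A] [Algebra K A] : Type (max v u) :=
  A →ₐ[K] K

/-- Zariski open sets of points: unions of principal open sets. -/
def IsZariskiOpen {K : Type u} {A : Type v} [Field K] [CommRing A] [Algebra K A]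
    (S : Set (Pts K A)) : Prop :=
  ∃ I : Set A, S = {x | ∃ f ∈ I, x f ≠ 0}

/-- A regular (left) action `G × X → X` of an affine algebraic group `G`, with algebra of regular
functions `R = K[G]`, on the affine variety `X` with coordinate ring `A`. Regularity says that the
pullback to `G × X` of a regular function on `X` lies in `K[G] ⊗ A`. -/
structure RegularAction {K : Type u} {G : Type w} [Field K] [Group G]
    (R : Subalgebra K (G → K)) (A : Type v) [CommRing A] [Algebra K A] where
  /-- the action on points -/
  act : G →* Equiv.Perm (Pts K A)
  regular : ∀ f : A, ∃ (n : ℕ) (φ : Fin n → R) (a : Fin n → A),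
    ∀ (g : G) (x : Pts K A), act g x f = ∑ i, (φ i : G → K) g * x (a i)

namespace RegularAction

variable {K : Type u} {G : Type w} [Field K] [Group G] {R : Subalgebra K (G → K)}
  {A : Type v} [CommRing A] [Algebra K A]

/-- The orbit of a point. -/
def orbit (ρ : RegularAction R A) (x : Pts K A) : Set (Pts K A) :=
  Set.range fun g : G => ρ.act g x

/-- The stabilizer of a point. -/
def stabilizer (ρ : RegularAction R A) (x : Pts K A) : Subgroup G :=
  (MulAction.stabilizer (Equiv.Perm (Pts K A)) x).comap ρ.act

/-- The action is locally transitive: there is an open orbit. -/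
def LocallyTransitive (ρ : RegularAction R A) : Prop :=
  ∃ x : Pts K A, IsZariskiOpen (ρ.orbit x)

/-- The action is transitive. -/
def Transitive (ρ : RegularAction R A) : Prop :=
  ∀ x y : Pts K A, ∃ g : G, ρ.act g x = y

/-- The subset `K[X]^H` of functions invariant under a subgroup `H` of `G`. -/
def invariants (ρ : RegularAction R A) (H : Set G) : Set A :=
  {f | ∀ h ∈ H, ∀ x : Pts K A, ρ.act h x f = x f}

end RegularAction

end Varieties

section SL2

universe u v w

/-- The algebra `K[SL(2)]` of regular functions on `SL(2)`, generated by the matrix entries. -/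
def sl2Functions (K : Type u) [Field K] : Subalgebra K (SL(2, K) → K) :=
  Algebra.adjoin K (Set.range fun (ij : Fin 2 × Fin 2) (g : SL(2, K)) => g.1 ij.1 ij.2)

/-- The unipotent subgroup `U` of lower triangular matrices with ones on the diagonal. -/
def lowerUnipotent (K : Type u) [Field K] : Set SL(2, K) :=
  {g | g.1 0 0 = 1 ∧ g.1 0 1 = 0 ∧ g.1 1 1 = 1}

variable {K : Type u} [Field K]

/-- The base point `y` defines an open equivariant embedding `SL(2) → Y`, `g ↦ g • y`: the orbit of
`y` is open and its stabilizer is trivial. (In characteristic zero the orbit map is then an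
isomorphism onto the orbit.) -/
def IsOpenEmbeddingAt {B : Type v} [CommRing B] [Algebra K B]
    (ρ : RegularAction (sl2Functions K) B) (y : Pts K B) : Prop :=
  IsZariskiOpen (ρ.orbit y) ∧ ρ.stabilizer y = ⊥

/-- An affine `SL(2)`-embedding: a three-dimensional variety with a locally transitive and locally
free `SL(2)`-action (normality, affineness and irreducibility are carried by the coordinate ring). -/
def IsSL2Embedding {B : Type v} [CommRing B] [Algebra K B]
    (ρ : RegularAction (sl2Functions K) B) : Prop :=
  ringKrullDim B = 3 ∧ ∃ y : Pts K B, IsOpenEmbeddingAt ρ y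

/-- An affine `SL(2)/ℤ_r`-embedding: a three-dimensional variety with a locally transitive but not
transitive `SL(2)`-action for which the stabilizer of a point of the open orbit is cyclic of
order `r`. -/
def IsSL2ModCyclicEmbedding {A : Type v} [CommRing A] [Algebra K A]
    (ρ : RegularAction (sl2Functions K) A) (r : ℕ) : Prop :=
  ringKrullDim A = 3 ∧ ¬ ρ.Transitive ∧
    ∃ x : Pts K A, IsZariskiOpen (ρ.orbit x) ∧
      IsCyclic (ρ.stabilizer x) ∧ Nat.card (ρ.stabilizer x) = r

/-- The `SL(2)`-embedding `Y` has height `h`: for some open equivariant embedding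
`φ : SL(2) → Y`, `g ↦ g • y`, the image `φ^*(K[Y]^U)` is spanned by the monomials `α ^ i * β ^ j`
with `j / i ≤ h` (where `i = j = 0` is allowed), `α` and `β` being the entries of the first row. -/
def EmbeddingHasHeight {B : Type v} [CommRing B] [Algebra K B]
    (ρ : RegularAction (sl2Functions K) B) (h : ℚ) : Prop :=
  ∃ y : Pts K B, IsOpenEmbeddingAt ρ y ∧
    (fun (f : B) (g : SL(2, K)) => ρ.act g y f) '' ρ.invariants (lowerUnipotent K) =
      (Submodule.span K {m : SL(2, K) → K | ∃ i j : ℕ, (j : ℚ) ≤ h * i ∧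
        m = fun g => g.1 0 0 ^ i * g.1 0 1 ^ j} : Set (SL(2, K) → K))

/-- `X ≅ Y // C` as `SL(2)`-varieties, where the finite subgroup `C` of `SL(2)` acts on the
`SL(2)`-embedding `Y` by an extension of its action on `SL(2) ⊆ Y` by right shifts. Here `θ c` is the
comorphism of the automorphism of `Y` that extends `g ↦ g * c`, and `π` is the comorphism of the
quotient morphism `Y → X`. -/
def IsRightQuotient {A : Type v} [CommRing A] [Algebra K A] {B : Type w} [CommRing B] [Algebra K B]
    (ρX : RegularAction (sl2Functions K) A) (ρY : RegularAction (sl2Functions K) B)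
    (C : Subgroup SL(2, K)) : Prop :=
  ∃ y : Pts K B, IsOpenEmbeddingAt ρY y ∧
    ∃ θ : C → (B →ₐ[K] B),
      (∀ (c : C) (g : SL(2, K)) (f : B), ρY.act g y (θ c f) = ρY.act (g * c) y f) ∧
      ∃ π : A →ₐ[K] B, Function.Injective π ∧
        Set.range π = {f | ∀ c : C, θ c f = f} ∧
        ∀ (g : SL(2, K)) (z : Pts K B), (ρY.act g z).comp π = ρX.act g (z.comp π)

/-- The `SL(2)/ℤ_r`-embedding `X` has height `h`: there is a normal affine `SL(2)`-embedding `Y` of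
height `h` with `X ≅ Y // ℤ_r`, where `ℤ_r ⊆ SL(2)` acts on `Y` by right shifts. -/
def HasHeight {A : Type v} [CommRing A] [Algebra K A]
    (ρ : RegularAction (sl2Functions K) A) (r : ℕ) (h : ℚ) : Prop :=
  ∃ (B : Type u) (_ : CommRing B) (_ : IsDomain B) (_ : IsIntegrallyClosed B) (_ : Algebra K B)
    (_ : Algebra.FiniteType K B) (ρY : RegularAction (sl2Functions K) B) (C : Subgroup SL(2, K)),
    IsSL2Embedding ρY ∧ EmbeddingHasHeight ρY h ∧
      IsCyclic C ∧ Nat.card C = r ∧ IsRightQuotient ρ ρY C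

end SL2

section Toric

universe u v

/-- The algebra of regular functions on the torus `T = (Kˣ)^n`: Laurent polynomials in the
coordinates. -/
def torusFunctions (K : Type u) [Field K] (n : ℕ) : Subalgebra K ((Fin n → Kˣ) → K) :=
  Algebra.adjoin K
    ((Set.range fun (i : Fin n) (t : Fin n → Kˣ) => (t i : K)) ∪
      Set.range fun (i : Fin n) (t : Fin n → Kˣ) => ((t i)⁻¹ : K))

/-- The character `χ^m : T → Kˣ` for `m` in the character lattice `M = ℤ^n`. -/
def character {K : Type u} [Field K] {n : ℕ} (m : Fin n → ℤ) (t : Fin n → Kˣ) : Kˣ :=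
  ∏ i, t i ^ m i

/-- The semigroup `M ∩ σ^∨` of lattice points in the dual of a cone `σ` in `N_ℚ = ℚ^n`. -/
def dualMonoid {n : ℕ} (σ : PointedCone ℚ (Fin n → ℚ)) : AddSubmonoid (Fin n → ℤ) where
  carrier := {m | ∀ w ∈ σ, 0 ≤ ∑ i, (m i : ℚ) * w i}
  zero_mem' := by
    intro w _
    simp
  add_mem' := by
    intro a b ha hb w hw
    have h := add_nonneg (ha w hw) (hb w hw)
    simpa [add_mul, Finset.sum_add_distrib] using h

/-- `X`, with the action `ρ` of the torus `T = (Kˣ)^n`, is a toric variety that corresponds to the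
cone `σ`: the action is locally transitive, `σ` is a strongly convex (rational) polyhedral cone in
`N_ℚ`, and `K[X]` is `T`-equivariantly isomorphic to the semigroup algebra `K[M ∩ σ^∨]`, in which the
basis element of `m` is the restriction of the character `χ^m`. -/
def IsToricWithCone {K : Type u} [Field K] {A : Type v} [CommRing A] [Algebra K A] {n : ℕ}
    (ρ : RegularAction (torusFunctions K n) A) (σ : PointedCone ℚ (Fin n → ℚ)) : Prop :=
  ρ.LocallyTransitive ∧ σ.FG ∧ (∀ w ∈ σ, -w ∈ σ → w = 0) ∧
    ∃ e : AddMonoidAlgebra K (dualMonoid σ) ≃ₐ[K] A,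
      ∀ (m : dualMonoid σ) (t : Fin n → Kˣ) (x : Pts K A),
        ρ.act t x (e (AddMonoidAlgebra.single m 1)) =
          (character m.1 t : K) * x (e (AddMonoidAlgebra.single m 1))

end Toric

end ToricSL2

open ToricSL2

/-!
An orbit map embeds the functions on a variety with an open orbit into the functions on `SL(2)`.
In characteristic zero a left-stable space of regular functions is determined by its `U`-invariants,
so an embedding of height `t / s` with `t < s` has as its functions the span of the monomials
`α ^ a * β ^ b * γ ^ c * δ ^ d` whose column degrees `i = a + c` and `j = b + d` satisfy
`s * j ≤ t * i`. A cyclic group of right shifts that preserves this span consists of upper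
triangular matrices, hence an upper unitriangular matrix conjugates it into the diagonal torus. The
invariants of `ℤ / (s - t)` are then spanned by the monomials with `i ≡ j` modulo `s - t`.
Multiplying such a monomial by a power of `α * δ - β * γ = 1` turns `(i, j)` into a multiple
`(s * z, t * z)` of `(s, t)`, and the monomials of these bidegrees are the characters of a torus
with coordinates `α / γ`, `β / δ` and `γ ^ s * δ ^ t` whose exponents lie in the dual cone, where
`s = l * q` and `t = l * p`.
-/

namespace ToricSL2

section Density

variable {K A : Type*} [Field K] [IsAlgClosed K] [CommRing A] [Algebra K A] [Algebra.FiniteType K A]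

theorem eq_zero_of_forall_pts [IsReduced A] {f : A} (hf : ∀ x : Pts K A, x f = 0) : f = 0 := by
  have hA : IsJacobsonRing A := isJacobsonRing_of_finiteType (A := K)
  have hbot : (⊥ : Ideal A).jacobson = ⊥ := hA.out Ideal.isRadical_bot
  rw [← Ideal.mem_bot, ← hbot, Ideal.jacobson, Ideal.mem_sInf]
  rintro m ⟨-, hm⟩
  let _ := Ideal.Quotient.field m
  have : Module.Finite K (A ⧸ m) := finite_of_finite_type_of_isJacobsonRing K (A ⧸ m)
  let residue : K ≃ₐ[K] A ⧸ m := AlgEquiv.ofBijective (Algebra.ofId K (A ⧸ m))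
    IsAlgClosed.algebraMap_bijective_of_isIntegral
  have hfm : residue.symm (Ideal.Quotient.mk m f) = 0 :=
    hf ((residue.symm : A ⧸ m →ₐ[K] K).comp (Ideal.Quotient.mkₐ K m))
  rwa [EmbeddingLike.map_eq_zero_iff, Ideal.Quotient.eq_zero_iff_mem] at hfm

theorem IsZariskiOpen.eq_zero [IsDomain A] {S : Set (Pts K A)} (hS : IsZariskiOpen S)
    (hne : S.Nonempty) {f : A} (hf : ∀ x ∈ S, x f = 0) : f = 0 := by
  obtain ⟨I, rfl⟩ := hS
  obtain ⟨x, h, hI, hx⟩ := hne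
  have hh : h ≠ 0 := by
    rintro rfl
    exact hx (map_zero x)
  refine (mul_eq_zero.mp (eq_zero_of_forall_pts (K := K) fun z => ?_)).resolve_right hh
  by_cases hz : z h = 0
  · rw [map_mul, hz, mul_zero]
  · rw [map_mul, hf z ⟨h, hI, hz⟩, zero_mul]

theorem IsZariskiOpen.inter_nonempty [IsDomain A] {S T : Set (Pts K A)} (hS : IsZariskiOpen S)
    (hT : IsZariskiOpen T) (hSne : S.Nonempty) (hTne : T.Nonempty) : (S ∩ T).Nonempty := by
  obtain ⟨I, rfl⟩ := hS
  obtain ⟨x, h, hI, hx⟩ := hSne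
  by_contra hST
  have hh : h = 0 := hT.eq_zero hTne fun z hz => by
    by_contra hzh
    exact hST ⟨z, ⟨h, hI, hzh⟩, hz⟩
  exact hx (by rw [hh, map_zero])

end Density

section Translates

variable {K G : Type*} [Field K] [Group G]

/-- The left translate `x ↦ F (g * x)` of a function `F` on a group. -/
def leftTranslate (g : G) : (G → K) →ₐ[K] (G → K) :=
  AlgHom.pi fun x => Pi.evalAlgHom K (fun _ => K) (g * x)

/-- The right translate `x ↦ F (x * g)` of a function `F` on a group. -/
def rightTranslate (g : G) : (G → K) →ₐ[K] (G → K) :=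
  AlgHom.pi fun x => Pi.evalAlgHom K (fun _ => K) (x * g)

@[simp]
theorem leftTranslate_apply (g : G) (F : G → K) (x : G) : leftTranslate g F x = F (g * x) := rfl

@[simp]
theorem rightTranslate_apply (g : G) (F : G → K) (x : G) : rightTranslate g F x = F (x * g) := rfl

theorem rightTranslate_rightTranslate (g h : G) (F : G → K) :
    rightTranslate g (rightTranslate h F) = rightTranslate (g * h) F := by
  ext x
  simp [mul_assoc]

@[simp]
theorem rightTranslate_one (F : G → K) : rightTranslate 1 F = F := by
  ext x
  simp

theorem rightTranslate_injective (g : G) :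
    Function.Injective (rightTranslate g : (G → K) →ₐ[K] (G → K)) := by
  intro F F' h
  ext x
  simpa using congrFun h (x * g⁻¹)

theorem rightTranslate_eq_of_mem_zpowers {c d : G} {F : G → K} (hc : rightTranslate c F = F)
    (hd : d ∈ Subgroup.zpowers c) : rightTranslate d F = F := by
  let stabilizer : Subgroup G :=
    { carrier := {g | rightTranslate g F = F}
      one_mem' := rightTranslate_one F
      mul_mem' := fun {g h} (hg : _ = F) (hh : _ = F) => show _ = F by
        rw [← rightTranslate_rightTranslate, hh, hg]
      inv_mem' := fun {g} (hg : _ = F) => rightTranslate_injective g (by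
        rw [rightTranslate_rightTranslate, mul_inv_cancel, rightTranslate_one, hg]) }
  exact (Subgroup.zpowers_le.mpr (show c ∈ stabilizer from hc)) hd

theorem mem_range_rightTranslate_comp_iff {A : Type*} [Semiring A] [Algebra K A]
    {ι : A →ₐ[K] (G → K)} {V : Set (G → K)} {u c d : G} (huc : u * c = d * u)
    (hV : ∀ F, rightTranslate u F ∈ V ↔ F ∈ V)
    (hι : ∀ F, F ∈ Set.range ι ↔ F ∈ V ∧ rightTranslate c F = F) (F : G → K) :
    F ∈ Set.range ((rightTranslate u).comp ι) ↔ F ∈ V ∧ rightTranslate d F = F := by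
  obtain ⟨F, rfl⟩ : ∃ F', rightTranslate u F' = F := ⟨rightTranslate u⁻¹ F, by
    rw [rightTranslate_rightTranslate, mul_inv_cancel, rightTranslate_one]⟩
  rw [rightTranslate_rightTranslate, ← huc, ← rightTranslate_rightTranslate, hV,
    (rightTranslate_injective u).eq_iff, ← hι, AlgHom.coe_comp, Set.range_comp,
    (rightTranslate_injective u).mem_set_image]

/-- A space of functions on a group is left stable if it contains the left translates of its
elements. -/
def IsLeftStable (S : Submodule K (G → K)) : Prop :=
  ∀ (g : G), ∀ F ∈ S, leftTranslate g F ∈ S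

end Translates

namespace RegularAction

variable {K G A : Type*} [Field K] [Group G] {R : Subalgebra K (G → K)} [CommRing A] [Algebra K A]

/-- The comorphism `A → K[G]` of the orbit map `g ↦ g • y`. -/
def orbitMap (ρ : RegularAction R A) (y : Pts K A) : A →ₐ[K] (G → K) :=
  AlgHom.pi fun g => ρ.act g y

/-- The regular functions on the variety, pulled back to the group along the orbit map of `y`. -/
def orbitFunctions (ρ : RegularAction R A) (y : Pts K A) : Submodule K (G → K) :=
  Subalgebra.toSubmodule (ρ.orbitMap y).range

@[simp]
theorem orbitMap_apply (ρ : RegularAction R A) (y : Pts K A) (f : A) (g : G) :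
    ρ.orbitMap y f g = ρ.act g y f := rfl

theorem orbit_nonempty (ρ : RegularAction R A) (y : Pts K A) : (ρ.orbit y).Nonempty :=
  ⟨_, 1, rfl⟩

theorem orbitFunctions_le (ρ : RegularAction R A) (y : Pts K A) :
    ρ.orbitFunctions y ≤ Subalgebra.toSubmodule R := by
  rintro _ ⟨f, rfl⟩
  obtain ⟨n, φ, a, h⟩ := ρ.regular f
  have hf : ρ.orbitMap y f = ∑ i, y (a i) • (φ i : G → K) := by
    ext g
    simp [h, mul_comm]
  exact hf ▸ sum_mem fun i _ => R.smul_mem (φ i).2 _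

theorem exists_translate (ρ : RegularAction R A) (g : G) (f : A) :
    ∃ f' : A, ∀ x : Pts K A, x f' = ρ.act g x f := by
  obtain ⟨n, φ, a, h⟩ := ρ.regular f
  exact ⟨∑ i, (φ i : G → K) g • a i, fun x => by simp [h]⟩

theorem isLeftStable_orbitFunctions (ρ : RegularAction R A) (y : Pts K A) :
    IsLeftStable (ρ.orbitFunctions y) := by
  rintro g _ ⟨f, rfl⟩
  obtain ⟨f', hf'⟩ := ρ.exists_translate g f
  exact ⟨f', by ext x; simp [hf']⟩

theorem orbitMap_act (ρ : RegularAction R A) (y : Pts K A) (g : G) (f : A) :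
    ρ.orbitMap (ρ.act g y) f = rightTranslate g (ρ.orbitMap y f) := by
  ext x
  simp

section OpenOrbit

variable [IsAlgClosed K] [IsDomain A] [Algebra.FiniteType K A] (ρ : RegularAction R A)

theorem orbitMap_injective {y : Pts K A} (hy : IsZariskiOpen (ρ.orbit y)) :
    Function.Injective (ρ.orbitMap y) := by
  rw [injective_iff_map_eq_zero]
  intro f hf
  refine hy.eq_zero (ρ.orbit_nonempty y) ?_
  rintro _ ⟨g, rfl⟩
  exact congrFun hf g

theorem exists_act_eq {x y : Pts K A} (hx : IsZariskiOpen (ρ.orbit x))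
    (hy : IsZariskiOpen (ρ.orbit y)) : ∃ g : G, ρ.act g x = y := by
  obtain ⟨_, ⟨g, rfl⟩, ⟨h, hgh⟩⟩ :=
    hx.inter_nonempty hy (ρ.orbit_nonempty x) (ρ.orbit_nonempty y)
  refine ⟨h⁻¹ * g, ?_⟩
  simp only at hgh
  rw [map_mul, Equiv.Perm.mul_apply, ← hgh, map_inv]
  exact (ρ.act h).symm_apply_apply y

theorem mem_invariants_of_orbitMap {y : Pts K A} (hy : IsZariskiOpen (ρ.orbit y)) {H : Set G}
    {f : A} (hf : ∀ h ∈ H, leftTranslate h (ρ.orbitMap y f) = ρ.orbitMap y f) :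
    f ∈ ρ.invariants H := by
  intro h hh x
  obtain ⟨f', hf'⟩ := ρ.exists_translate h f
  have hff' : f' = f := ρ.orbitMap_injective hy (by
    rw [← hf h hh]
    ext g
    simp [hf'])
  rw [← hf', hff']

end OpenOrbit

end RegularAction

section Polynomials

open Polynomial

theorem coeff_C_mul_X_add_C_pow {R : Type*} [CommSemiring R] (a b : R) (n k : ℕ) :
    ((C a * X + C b) ^ n).coeff k = b ^ (n - k) * n.choose k * a ^ k := by
  have h := comp_C_mul_X_coeff (p := (X + C b) ^ n) (r := a) (n := k)
  rwa [pow_comp, add_comp, X_comp, C_comp, coeff_X_add_C_pow] at h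

theorem natDegree_C_mul_X_add_C_pow_le {R : Type*} [Semiring R] (a b : R) (n : ℕ) :
    ((C a * X + C b) ^ n).natDegree ≤ n := by
  simpa using natDegree_pow_le_of_le n (natDegree_linear_le (a := a) (b := b))

theorem coeff_mem_of_forall_eval_mem {K R : Type*} [Field K] [Infinite K] [Ring R] [Algebra K R]
    {S : Submodule K R} {P : R[X]} (h : ∀ s : K, P.eval (algebraMap K R s) ∈ S) (k : ℕ) :
    P.coeff k ∈ S := by
  -- Otherwise a linear form vanishing on `S` turns the curve into a nonzero polynomial with
  -- infinitely many roots.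
  by_contra hk
  obtain ⟨φ, hφ, hS⟩ := Submodule.exists_le_ker_of_notMem hk
  have hzero : ∑ i ∈ P.support, monomial i (φ (P.coeff i)) = 0 := Polynomial.funext fun s => by
    have hs : φ (P.eval (algebraMap K R s)) = 0 := hS (h s)
    rw [eval_eq_sum, Polynomial.sum] at hs
    simpa [eval_finsetSum, ← map_pow, ← Algebra.commutes, ← Algebra.smul_def, mul_comm] using hs
  refine hφ ?_
  have hcoeff := congrArg (fun Q => Q.coeff k) hzero
  by_cases hPk : P.coeff k = 0
  · rw [hPk, map_zero]
  · simpa [finsetSum_coeff, coeff_monomial, hPk] using hcoeff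

end Polynomials

section Monomials

variable {K : Type*} [Field K]

/-- The matrix entry in position `(i, j)`, as a function on `SL(2)`. -/
def entry (i j : Fin 2) : SL(2, K) → K := fun g => g.1 i j

/-- The function `α ^ a * β ^ b * γ ^ c * δ ^ d` on `SL(2)`, where `α, β` and `γ, δ` are the entries
of the first and of the second row of a matrix. -/
def entryMonomial (a b c d : ℕ) : SL(2, K) → K :=
  entry 0 0 ^ a * entry 0 1 ^ b * entry 1 0 ^ c * entry 1 1 ^ d

/-- The span of the monomials `α ^ a * β ^ b * γ ^ c * δ ^ d` whose degrees `a + c` in the first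
column, `b + d` in the second column and `c + d` in the second row satisfy the predicate `P`. -/
def degreeSpan (K : Type*) [Field K] (P : ℕ → ℕ → ℕ → Prop) : Submodule K (SL(2, K) → K) :=
  Submodule.span K {F | ∃ a b c d, P (a + c) (b + d) (c + d) ∧ F = entryMonomial a b c d}

/-- The span of the monomials whose pair of column degrees lies in `E`. -/
abbrev bidegreeSpan (K : Type*) [Field K] (E : Set (ℕ × ℕ)) : Submodule K (SL(2, K) → K) :=
  degreeSpan K fun i j _ => (i, j) ∈ E

/-- The monomial `α ^ i * β ^ j` in the entries of the first row. -/
def rowMonomial (K : Type*) [Field K] (ij : ℕ × ℕ) : SL(2, K) → K :=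
  entryMonomial ij.1 ij.2 0 0

/-- The span of the monomials in the entries of the first row with exponents in `E`. -/
def rowSpan (K : Type*) [Field K] (E : Set (ℕ × ℕ)) : Submodule K (SL(2, K) → K) :=
  Submodule.span K (rowMonomial K '' E)

@[simp]
theorem entry_apply (i j : Fin 2) (g : SL(2, K)) : entry i j g = g.1 i j := rfl

theorem entryMonomial_apply (a b c d : ℕ) (g : SL(2, K)) :
    entryMonomial a b c d g = g.1 0 0 ^ a * g.1 0 1 ^ b * g.1 1 0 ^ c * g.1 1 1 ^ d := rfl

theorem rowMonomial_apply (ij : ℕ × ℕ) (g : SL(2, K)) :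
    rowMonomial K ij g = g.1 0 0 ^ ij.1 * g.1 0 1 ^ ij.2 := by
  simp [rowMonomial, entryMonomial_apply]

theorem entryMonomial_mul_entryMonomial (a b c d a' b' c' d' : ℕ) :
    (entryMonomial a b c d * entryMonomial a' b' c' d' : SL(2, K) → K) =
      entryMonomial (a + a') (b + b') (c + c') (d + d') := by
  simp only [entryMonomial]
  ring

theorem sl2_det (g : SL(2, K)) : g.1 0 0 * g.1 1 1 - g.1 0 1 * g.1 1 0 = 1 := by
  rw [← Matrix.det_fin_two]
  exact g.2

theorem entryMonomial_succ_sub_entryMonomial_succ (a b c d : ℕ) :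
    (entryMonomial (a + 1) b c (d + 1) - entryMonomial a (b + 1) (c + 1) d : SL(2, K) → K) =
      entryMonomial a b c d := by
  ext g
  simp only [Pi.sub_apply, entryMonomial_apply]
  linear_combination (g.1 0 0 ^ a * g.1 0 1 ^ b * g.1 1 0 ^ c * g.1 1 1 ^ d) * sl2_det g

theorem entryMonomial_mem_degreeSpan {P : ℕ → ℕ → ℕ → Prop} {a b c d : ℕ}
    (h : P (a + c) (b + d) (c + d)) : entryMonomial a b c d ∈ degreeSpan K P :=
  Submodule.subset_span ⟨a, b, c, d, h, rfl⟩

theorem degreeSpan_le {P : ℕ → ℕ → ℕ → Prop} {S : Submodule K (SL(2, K) → K)} :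
    degreeSpan K P ≤ S ↔
      ∀ a b c d, P (a + c) (b + d) (c + d) → entryMonomial a b c d ∈ S := by
  refine Submodule.span_le.trans ⟨fun h a b c d hP => h ⟨a, b, c, d, hP, rfl⟩, ?_⟩
  rintro h _ ⟨a, b, c, d, hP, rfl⟩
  exact h a b c d hP

theorem degreeSpan_mono {P Q : ℕ → ℕ → ℕ → Prop} (h : ∀ i j k, P i j k → Q i j k) :
    degreeSpan K P ≤ degreeSpan K Q :=
  degreeSpan_le.mpr fun _ _ _ _ hP => entryMonomial_mem_degreeSpan (h _ _ _ hP)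

theorem rowSpan_le {E : Set (ℕ × ℕ)} {S : Submodule K (SL(2, K) → K)} :
    rowSpan K E ≤ S ↔ ∀ ij ∈ E, rowMonomial K ij ∈ S :=
  Submodule.span_le.trans Set.forall_mem_image

theorem rowMonomial_mem_rowSpan {E : Set (ℕ × ℕ)} {ij : ℕ × ℕ} (h : ij ∈ E) :
    rowMonomial K ij ∈ rowSpan K E :=
  Submodule.subset_span ⟨ij, h, rfl⟩

theorem sl2Functions_le_degreeSpan :
    Subalgebra.toSubmodule (sl2Functions K) ≤ degreeSpan K fun _ _ _ => True := by
  intro F hF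
  have mem_of_eq (a b c d : ℕ) {F : SL(2, K) → K} (h : ∀ g, F g = entryMonomial a b c d g) :
      F ∈ degreeSpan K fun _ _ _ => True :=
    funext h ▸ entryMonomial_mem_degreeSpan trivial
  change F ∈ Algebra.adjoin K _ at hF
  induction hF using Algebra.adjoin_induction with
  | mem F h =>
    obtain ⟨⟨i, j⟩, rfl⟩ := h
    fin_cases i <;> fin_cases j
    · exact mem_of_eq 1 0 0 0 fun g => by simp [entryMonomial_apply]
    · exact mem_of_eq 0 1 0 0 fun g => by simp [entryMonomial_apply]
    · exact mem_of_eq 0 0 1 0 fun g => by simp [entryMonomial_apply]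
    · exact mem_of_eq 0 0 0 1 fun g => by simp [entryMonomial_apply]
  | algebraMap r =>
    rw [Algebra.algebraMap_eq_smul_one]
    exact Submodule.smul_mem _ _ (mem_of_eq 0 0 0 0 fun g => by simp [entryMonomial_apply])
  | add F G _ _ hF hG => exact add_mem hF hG
  | mul F G _ _ hF hG =>
    have hFG := Submodule.mul_mem_mul hF hG
    rw [degreeSpan, Submodule.span_mul_span] at hFG
    refine Submodule.span_le.mpr ?_ hFG
    rintro _ ⟨_, ⟨a, b, c, d, -, rfl⟩, _, ⟨a', b', c', d', -, rfl⟩, rfl⟩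
    exact mem_of_eq _ _ _ _ (congrFun (entryMonomial_mul_entryMonomial a b c d a' b' c' d'))

theorem entryMonomial_add_sub_entryMonomial_add_mem (a b c d n : ℕ) :
    (entryMonomial (a + n) b c (d + n) - entryMonomial a (b + n) (c + n) d : SL(2, K) → K) ∈
      degreeSpan K fun i j k => i + 1 = a + c + n ∧ j + 1 = b + d + n ∧ k + 1 = c + d + n := by
  induction n generalizing b c with
  | zero => simp
  | succ n ih =>
    have hn := ih (b + 1) (c + 1)
    rw [← sub_add_sub_cancel _ (entryMonomial (a + n) (b + 1) (c + 1) (d + n))]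
    refine add_mem ?_ ?_
    · rw [← add_assoc a, ← add_assoc d, entryMonomial_succ_sub_entryMonomial_succ]
      exact entryMonomial_mem_degreeSpan ⟨by omega, by omega, by omega⟩
    · rw [add_assoc b 1 n, add_assoc c 1 n, add_comm 1 n] at hn
      exact degreeSpan_mono (fun _ _ _ => by omega) hn

theorem entryMonomial_sub_entryMonomial_mem {i j k a b c d a' b' c' d' : ℕ}
    (hi : a + c = i) (hj : b + d = j) (hk : c + d = k)
    (hi' : a' + c' = i) (hj' : b' + d' = j) (hk' : c' + d' = k) :
    (entryMonomial a b c d - entryMonomial a' b' c' d' : SL(2, K) → K) ∈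
      degreeSpan K fun i' j' k' => i' + 1 = i ∧ j' + 1 = j ∧ k' + 1 = k := by
  wlog h : a' ≤ a generalizing a b c d a' b' c' d'
  · rw [← neg_mem_iff, neg_sub]
    exact this hi' hj' hk' hi hj hk (le_of_not_ge h)
  obtain ⟨n, rfl⟩ := Nat.exists_eq_add_of_le h
  obtain rfl : c' = c + n := by omega
  obtain rfl : d = d' + n := by omega
  obtain rfl : b' = b + n := by omega
  exact degreeSpan_mono (fun _ _ _ => by omega)
    (entryMonomial_add_sub_entryMonomial_add_mem a' b c d' n)

end Monomials

section Unipotents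

variable {K : Type*} [Field K]

/-- The upper unitriangular matrix with off-diagonal entry `s`. -/
def upperElem (s : K) : SL(2, K) := ⟨!![1, s; 0, 1], by simp⟩

/-- The lower unitriangular matrix with off-diagonal entry `s`. -/
def lowerElem (s : K) : SL(2, K) := ⟨!![1, 0; s, 1], by simp⟩

theorem sl2_mul_apply (g h : SL(2, K)) (i j : Fin 2) :
    (g * h).1 i j = g.1 i 0 * h.1 0 j + g.1 i 1 * h.1 1 j := by
  rw [← Fin.sum_univ_two (fun k => g.1 i k * h.1 k j)]
  exact Matrix.mul_apply

section Entries

variable (s : K)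

@[simp] theorem upperElem_zero_zero : (upperElem s).1 0 0 = 1 := rfl
@[simp] theorem upperElem_zero_one : (upperElem s).1 0 1 = s := rfl
@[simp] theorem upperElem_one_zero : (upperElem s).1 1 0 = 0 := rfl
@[simp] theorem upperElem_one_one : (upperElem s).1 1 1 = 1 := rfl
@[simp] theorem lowerElem_zero_zero : (lowerElem s).1 0 0 = 1 := rfl
@[simp] theorem lowerElem_zero_one : (lowerElem s).1 0 1 = 0 := rfl
@[simp] theorem lowerElem_one_zero : (lowerElem s).1 1 0 = s := rfl
@[simp] theorem lowerElem_one_one : (lowerElem s).1 1 1 = 1 := rfl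

end Entries

end Unipotents

section Generation

open Polynomial

variable {K : Type*} [Field K]

/-- The left translates of `α ^ i * β ^ j` by the upper unitriangular matrices, as a polynomial in
the off-diagonal entry. -/
noncomputable def upperCurve (K : Type*) [Field K] (i j : ℕ) : (SL(2, K) → K)[X] :=
  (C (entry 1 0) * X + C (entry 0 0)) ^ i * (C (entry 1 1) * X + C (entry 0 1)) ^ j

theorem leftTranslate_upperElem_rowMonomial (s : K) (ij : ℕ × ℕ) :
    leftTranslate (upperElem s) (rowMonomial K ij) =
      (upperCurve K ij.1 ij.2).eval (algebraMap K _ s) := by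
  ext x
  simp only [leftTranslate_apply, rowMonomial_apply, sl2_mul_apply, upperCurve,
    upperElem_zero_zero, upperElem_zero_one, one_mul, eval_mul, eval_pow, eval_add, eval_C, eval_X,
    Pi.mul_apply, Pi.pow_apply, Pi.add_apply, entry_apply, Pi.algebraMap_apply,
    Algebra.algebraMap_self, RingHom.id_apply]
  ring

theorem coeff_upperCurve (i j k : ℕ) :
    (upperCurve K i j).coeff k = ∑ t ∈ Finset.HasAntidiagonal.antidiagonal k,
      (i.choose t.1 * j.choose t.2) • entryMonomial (i - t.1) (j - t.2) t.1 t.2 := by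
  rw [upperCurve, coeff_mul]
  refine Finset.sum_congr rfl fun t _ => ?_
  rw [coeff_C_mul_X_add_C_pow, coeff_C_mul_X_add_C_pow, entryMonomial, nsmul_eq_mul, Nat.cast_mul]
  ring

theorem coeff_upperCurve_sub_mem (a b c d : ℕ) :
    (upperCurve K (a + c) (b + d)).coeff (c + d) -
        (a + c + (b + d)).choose (c + d) • entryMonomial a b c d ∈
      degreeSpan K fun i j k => i + 1 = a + c ∧ j + 1 = b + d ∧ k + 1 = c + d := by
  rw [coeff_upperCurve, Nat.add_choose_eq, Finset.sum_smul, ← Finset.sum_sub_distrib]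
  refine sum_mem fun t ht => ?_
  have hk : t.1 + t.2 = c + d := Finset.HasAntidiagonal.mem_antidiagonal.mp ht
  rw [← smul_sub]
  by_cases hi : t.1 ≤ a + c
  · by_cases hj : t.2 ≤ b + d
    · exact nsmul_mem (entryMonomial_sub_entryMonomial_mem (Nat.sub_add_cancel hi)
        (Nat.sub_add_cancel hj) hk rfl rfl rfl) _
    · simp [Nat.choose_eq_zero_of_lt (not_le.mp hj)]
  · simp [Nat.choose_eq_zero_of_lt (not_le.mp hi)]

theorem bidegreeSpan_le_of_rowSpan_le [CharZero K] {S : Submodule K (SL(2, K) → K)}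
    (hS : IsLeftStable S) {E : Set (ℕ × ℕ)} (hE : ∀ i j, (i + 1, j + 1) ∈ E → (i, j) ∈ E)
    (hES : rowSpan K E ≤ S) : bidegreeSpan K E ≤ S := by
  refine degreeSpan_le.mpr fun a b c d hij => ?_
  induction hi : a + c using Nat.strong_induction_on generalizing a b c d with
  | _ i ih =>
    have hcurve : (upperCurve K (a + c) (b + d)).coeff (c + d) ∈ S :=
      coeff_mem_of_forall_eval_mem (fun s => by
        rw [← leftTranslate_upperElem_rowMonomial s (_, _)]
        exact hS _ _ (hES (rowMonomial_mem_rowSpan hij))) _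
    have hlower : (degreeSpan K fun i' j' k' => i' + 1 = a + c ∧ j' + 1 = b + d ∧ k' + 1 = c + d) ≤
        S := degreeSpan_le.mpr fun a' b' c' d' ⟨hi', hj', _⟩ =>
      ih _ (by omega) a' b' c' d' (hE _ _ (by rwa [hi', hj'])) rfl
    have hsmul := sub_mem hcurve (hlower (coeff_upperCurve_sub_mem a b c d))
    rw [sub_sub_cancel, ← Nat.cast_smul_eq_nsmul K] at hsmul
    exact (S.smul_mem_iff (Nat.cast_ne_zero.mpr (Nat.choose_pos (by omega)).ne')).mp hsmul

end Generation

section LowerSymbols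

open Polynomial

variable {K : Type*} [Field K]

/-- The pairs `(F, H)` for which the translates of `F` by the lower unitriangular matrices are
polynomial of degree at most `n` in the off-diagonal entry, with `n`-th coefficient `H`. -/
def lowerSymbol (K : Type*) [Field K] (n : ℕ) :
    Submodule K ((SL(2, K) → K) × (SL(2, K) → K)) where
  carrier := {FH | ∃ P : (SL(2, K) → K)[X], P.natDegree ≤ n ∧ P.coeff n = FH.2 ∧
    ∀ s, leftTranslate (lowerElem s) FH.1 = P.eval (algebraMap K _ s)}
  zero_mem' := ⟨0, by simp, by simp, fun s => by simp⟩
  add_mem' := by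
    rintro _ _ ⟨P, hdeg, htop, heval⟩ ⟨P', hdeg', htop', heval'⟩
    exact ⟨P + P', natDegree_add_le_of_degree_le hdeg hdeg', by simp [htop, htop'],
      fun s => by simp [heval, heval']⟩
  smul_mem' := by
    rintro r _ ⟨P, hdeg, htop, heval⟩
    exact ⟨r • P, (natDegree_smul_le _ _).trans hdeg, by simp [htop], fun s => by simp [heval]⟩

theorem mk_mem_lowerSymbol {n : ℕ} {F H : SL(2, K) → K} :
    (F, H) ∈ lowerSymbol K n ↔ ∃ P : (SL(2, K) → K)[X], P.natDegree ≤ n ∧ P.coeff n = H ∧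
      ∀ s, leftTranslate (lowerElem s) F = P.eval (algebraMap K _ s) := Iff.rfl

theorem lowerSymbol_zero_of_lt {m n : ℕ} {F H : SL(2, K) → K} (h : (F, H) ∈ lowerSymbol K m)
    (hmn : m < n) : (F, 0) ∈ lowerSymbol K n := by
  obtain ⟨P, hdeg, -, heval⟩ := h
  exact ⟨P, hdeg.trans hmn.le, coeff_eq_zero_of_natDegree_lt (hdeg.trans_lt hmn), heval⟩

theorem entryMonomial_rowMonomial_mem_lowerSymbol (a b c d : ℕ) :
    (entryMonomial a b c d, rowMonomial K (a + c, b + d)) ∈ lowerSymbol K (c + d) := by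
  have coeff_top (f g : SL(2, K) → K) (m : ℕ) : ((C f * X + C g) ^ m).coeff m = f ^ m := by
    simp [coeff_C_mul_X_add_C_pow]
  refine mk_mem_lowerSymbol.mpr ⟨C (entryMonomial a b 0 0) *
    ((C (entry 0 0) * X + C (entry 1 0)) ^ c * (C (entry 0 1) * X + C (entry 1 1)) ^ d), ?_, ?_, ?_⟩
  · exact (natDegree_C_mul_le _ _).trans (natDegree_mul_le_of_le
      (natDegree_C_mul_X_add_C_pow_le _ _ _) (natDegree_C_mul_X_add_C_pow_le _ _ _))
  · rw [coeff_C_mul, coeff_mul_add_eq_of_natDegree_le (natDegree_C_mul_X_add_C_pow_le _ _ _)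
      (natDegree_C_mul_X_add_C_pow_le _ _ _), coeff_top, coeff_top, rowMonomial]
    simp only [entryMonomial]
    ring
  · intro s
    ext x
    simp only [entryMonomial, leftTranslate_apply, Pi.mul_apply, Pi.pow_apply, Pi.add_apply,
      entry_apply, sl2_mul_apply, lowerElem_zero_zero, lowerElem_zero_one, lowerElem_one_zero,
      lowerElem_one_one, one_mul, zero_mul, add_zero, pow_zero, mul_one, eval_mul, eval_pow,
      eval_C, eval_add, eval_X, Pi.algebraMap_apply, Algebra.algebraMap_self, RingHom.id_apply]
    ring

theorem mem_of_mem_lowerSymbol [Infinite K] {n : ℕ} {F H : SL(2, K) → K}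
    (h : (F, H) ∈ lowerSymbol K n) {S : Submodule K (SL(2, K) → K)} (hS : IsLeftStable S)
    (hF : F ∈ S) : H ∈ S := by
  obtain ⟨P, -, rfl, heval⟩ := h
  exact coeff_mem_of_forall_eval_mem (fun s => heval s ▸ hS _ F hF) n

theorem zero_mem_lowerSymbol_of_mem_degreeSpan {n : ℕ} {F : SL(2, K) → K}
    (hF : F ∈ degreeSpan K fun _ _ k => k < n) : (F, 0) ∈ lowerSymbol K n := by
  suffices (degreeSpan K fun _ _ k => k < n) ≤ (lowerSymbol K n).comap (LinearMap.inl K _ _) from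
    this hF
  exact degreeSpan_le.mpr fun a b c d h =>
    lowerSymbol_zero_of_lt (entryMonomial_rowMonomial_mem_lowerSymbol a b c d) h

end LowerSymbols

section Independence

variable {K : Type*} [Field K] [Infinite K]

theorem linearIndependent_of_forall_exists_eq_prod_pow {σ ι Ω : Type*} [Fintype σ]
    {q : MvPolynomial σ K} (hq : q ≠ 0) {e : ι → σ → ℕ} (he : Function.Injective e)
    {f : ι → Ω → K}
    (hf : ∀ t : σ → K, MvPolynomial.eval t q ≠ 0 → ∃ ω, ∀ i, f i ω = ∏ j, t j ^ e i j) :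
    LinearIndependent K f := by
  classical
  rw [linearIndependent_iff]
  intro c hc
  let exponent (i : ι) : σ →₀ ℕ := Finsupp.equivFunOnFinite.symm (e i)
  have hexp : Function.Injective exponent := Finsupp.equivFunOnFinite.symm.injective.comp he
  have hmul : (∑ i ∈ c.support, MvPolynomial.monomial (exponent i) (c i)) * q = 0 := by
    refine MvPolynomial.funext fun t => ?_
    by_cases ht : MvPolynomial.eval t q = 0
    · simp [ht]
    · obtain ⟨ω, hω⟩ := hf t ht
      have hcω := congrFun hc ω
      rw [Finsupp.linearCombination_apply, Finsupp.sum, Finset.sum_apply] at hcω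
      rw [map_mul, map_sum, map_zero]
      refine mul_eq_zero_of_left (Eq.trans (Finset.sum_congr rfl fun i _ => ?_) hcω) _
      simp [MvPolynomial.eval_monomial, Finsupp.prod_fintype, hω, exponent]
  ext i
  have hcoeff := congrArg (MvPolynomial.coeff (exponent i)) ((mul_eq_zero.mp hmul).resolve_right hq)
  simpa [MvPolynomial.coeff_sum, MvPolynomial.coeff_monomial, hexp.eq_iff] using hcoeff

theorem linearIndependent_rowMonomial : LinearIndependent K (rowMonomial K) := by
  refine linearIndependent_of_forall_exists_eq_prod_pow (σ := Fin 2)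
    (MvPolynomial.X_ne_zero (0 : Fin 2)) (e := fun ij => ![ij.1, ij.2]) ?_ ?_
  · intro ij ij' h
    exact Prod.ext (congrFun h 0) (congrFun h 1)
  · intro t ht
    rw [MvPolynomial.eval_X] at ht
    exact ⟨⟨!![t 0, t 1; 0, (t 0)⁻¹], by simp [Matrix.det_fin_two, ht]⟩, fun ij =>
      (rowMonomial_apply ij _).trans (by simp)⟩

theorem support_subset_of_linearCombination_rowMonomial_mem {c : ℕ × ℕ →₀ K} {E : Set (ℕ × ℕ)}
    (h : Finsupp.linearCombination K (rowMonomial K) c ∈ rowSpan K E) : ↑c.support ⊆ E := by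
  obtain ⟨c', hc', hcc'⟩ := (Finsupp.mem_span_image_iff_linearCombination K).mp h
  rw [← linearIndependent_rowMonomial hcc']
  exact (Finsupp.mem_supported K c').mp hc'

end Independence

section Classification

variable {K : Type*} [Field K]

/-- A distinguished monomial with column degrees `ij` and with degree `n` in the second row; the
degrees are as stated if `n ≤ ij.1 + ij.2`. -/
def normalMonomial (K : Type*) [Field K] (n : ℕ) (ij : ℕ × ℕ) : SL(2, K) → K :=
  entryMonomial (ij.1 - min ij.1 n) (ij.2 - (n - min ij.1 n)) (min ij.1 n) (n - min ij.1 n)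

theorem normalMonomial_mem_bidegreeSpan {n : ℕ} {E : Set (ℕ × ℕ)} {ij : ℕ × ℕ}
    (h : n ≤ ij.1 + ij.2) (hE : ij ∈ E) : normalMonomial K n ij ∈ bidegreeSpan K E := by
  refine entryMonomial_mem_degreeSpan ?_
  rwa [Nat.sub_add_cancel (min_le_left _ _), Nat.sub_add_cancel (by omega)]

theorem normalMonomial_rowMonomial_mem_lowerSymbol {n : ℕ} {ij : ℕ × ℕ} (h : n ≤ ij.1 + ij.2) :
    (normalMonomial K n ij, rowMonomial K ij) ∈ lowerSymbol K n := by
  have hi : ij.1 - min ij.1 n + min ij.1 n = ij.1 := by omega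
  have hj : ij.2 - (n - min ij.1 n) + (n - min ij.1 n) = ij.2 := by omega
  have hn : min ij.1 n + (n - min ij.1 n) = n := by omega
  have hmem := entryMonomial_rowMonomial_mem_lowerSymbol (K := K) (ij.1 - min ij.1 n)
    (ij.2 - (n - min ij.1 n)) (min ij.1 n) (n - min ij.1 n)
  rwa [hi, hj, hn] at hmem

theorem linearCombination_mem_lowerSymbol {n : ℕ} {c : ℕ × ℕ →₀ K}
    (hc : c ∈ Finsupp.supported K K {ij : ℕ × ℕ | n ≤ ij.1 + ij.2}) :
    (Finsupp.linearCombination K (normalMonomial K n) c,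
      Finsupp.linearCombination K (rowMonomial K) c) ∈ lowerSymbol K n := by
  suffices Finsupp.supported K K {ij : ℕ × ℕ | n ≤ ij.1 + ij.2} ≤
      (lowerSymbol K n).comap ((Finsupp.linearCombination K (normalMonomial K n)).prod
        (Finsupp.linearCombination K (rowMonomial K))) from this hc
  rw [Finsupp.supported_eq_span_single, Submodule.span_le, Set.image_subset_iff]
  intro ij hij
  simpa using normalMonomial_rowMonomial_mem_lowerSymbol hij

theorem exists_sub_linearCombination_mem_degreeSpan {n : ℕ} {F : SL(2, K) → K}
    (hF : F ∈ degreeSpan K fun _ _ k => k < n + 1) :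
    ∃ c ∈ Finsupp.supported K K {ij : ℕ × ℕ | n ≤ ij.1 + ij.2},
      F - Finsupp.linearCombination K (normalMonomial K n) c ∈ degreeSpan K fun _ _ k => k < n := by
  suffices (degreeSpan K fun _ _ k => k < n + 1) ≤
      (degreeSpan K fun _ _ k => k < n) ⊔
        Submodule.span K (normalMonomial K n '' {ij : ℕ × ℕ | n ≤ ij.1 + ij.2}) by
    obtain ⟨G, hG, H, hH, rfl⟩ := Submodule.mem_sup.mp (this hF)
    obtain ⟨c, hc, rfl⟩ := (Finsupp.mem_span_image_iff_linearCombination K).mp hH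
    exact ⟨c, hc, by rwa [add_sub_cancel_right]⟩
  refine degreeSpan_le.mpr fun a b c d h => ?_
  rcases Nat.lt_succ_iff_lt_or_eq.mp h with h | rfl
  · exact Submodule.mem_sup_left (entryMonomial_mem_degreeSpan h)
  · rw [← sub_add_cancel (entryMonomial a b c d) (normalMonomial K (c + d) (a + c, b + d))]
    refine Submodule.add_mem_sup (degreeSpan_mono (fun _ _ _ h => ?_)
      (entryMonomial_sub_entryMonomial_mem rfl rfl rfl ?_ ?_ ?_))
      (Submodule.subset_span ⟨_, show c + d ≤ a + c + (b + d) by omega, rfl⟩)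
    all_goals omega

theorem exists_mem_degreeSpan_lt {F : SL(2, K) → K} (hF : F ∈ degreeSpan K fun _ _ _ => True) :
    ∃ n, F ∈ degreeSpan K fun _ _ k => k < n := by
  have hmono : Monotone fun n => degreeSpan K fun _ _ k => k < n := fun m n hmn =>
    degreeSpan_mono fun _ _ _ hk => hk.trans_le hmn
  rw [← Submodule.mem_iSup_of_directed _ hmono.directed_le]
  refine degreeSpan_le.mpr (fun a b c d _ => ?_) hF
  exact Submodule.mem_iSup_of_mem (c + d + 1) (entryMonomial_mem_degreeSpan (Nat.lt_succ_self _))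

theorem eq_bidegreeSpan [CharZero K] {S : Submodule K (SL(2, K) → K)} (hS : IsLeftStable S)
    (hreg : S ≤ Subalgebra.toSubmodule (sl2Functions K)) {E : Set (ℕ × ℕ)}
    (hE : ∀ i j, (i + 1, j + 1) ∈ E → (i, j) ∈ E)
    (hSE : S ⊓ rowSpan K Set.univ = rowSpan K E) : S = bidegreeSpan K E := by
  have hle : bidegreeSpan K E ≤ S := bidegreeSpan_le_of_rowSpan_le hS hE (hSE ▸ inf_le_left)
  refine le_antisymm (fun F hF => ?_) hle
  obtain ⟨n, hn⟩ := exists_mem_degreeSpan_lt (sl2Functions_le_degreeSpan (hreg hF))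
  induction n generalizing F with
  | zero =>
    suffices F = 0 from this ▸ zero_mem _
    simpa [degreeSpan] using hn
  | succ n ih =>
    obtain ⟨c, hc, hlow⟩ := exists_sub_linearCombination_mem_degreeSpan hn
    set N := Finsupp.linearCombination K (normalMonomial K n) c with hN
    have hsymbol : (F, Finsupp.linearCombination K (rowMonomial K) c) ∈ lowerSymbol K n := by
      simpa [hN] using add_mem (zero_mem_lowerSymbol_of_mem_degreeSpan hlow)
        (linearCombination_mem_lowerSymbol hc)
    have hrow : Finsupp.linearCombination K (rowMonomial K) c ∈ rowSpan K Set.univ :=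
      (Finsupp.mem_span_image_iff_linearCombination K).mpr ⟨c, by simp, rfl⟩
    have hcE : ↑c.support ⊆ E := support_subset_of_linearCombination_rowMonomial_mem
      (hSE.le ⟨mem_of_mem_lowerSymbol hsymbol hS hF, hrow⟩)
    have hNE : N ∈ bidegreeSpan K E := by
      rw [hN, Finsupp.linearCombination_apply]
      exact sum_mem fun ij hij => Submodule.smul_mem _ _
        (normalMonomial_mem_bidegreeSpan ((Finsupp.mem_supported _ _).mp hc hij) (hcE hij))
    rw [← sub_add_cancel F N]
    exact add_mem (ih _ (sub_mem hF (hle hNE)) hlow) hNE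

end Classification

section Torus

variable {K : Type*} [Field K] {n : ℕ}

theorem character_add (m m' : Fin n → ℤ) (t : Fin n → Kˣ) :
    character (m + m') t = character m t * character m' t := by
  simp [character, zpow_add, Finset.prod_mul_distrib]

@[simp]
theorem character_zero (t : Fin n → Kˣ) : character 0 t = 1 := by simp [character]

theorem character_mul (m : Fin n → ℤ) (s t : Fin n → Kˣ) :
    character m (s * t) = character m s * character m t := by
  simp [character, mul_zpow, Finset.prod_mul_distrib]

@[simp]
theorem character_one (m : Fin n → ℤ) : character m (1 : Fin n → Kˣ) = 1 := by simp [character]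

theorem coe_zpow_mem_torusFunctions (i : Fin n) (k : ℤ) :
    (fun t : Fin n → Kˣ => ((t i ^ k : Kˣ) : K)) ∈ torusFunctions K n := by
  cases k with
  | ofNat k =>
    have coord_mem : (fun t : Fin n → Kˣ => (t i : K)) ∈ torusFunctions K n :=
      Algebra.subset_adjoin (Or.inl ⟨i, rfl⟩)
    convert pow_mem coord_mem k using 1
    ext t
    simp
  | negSucc k =>
    have inv_coord_mem : (fun t : Fin n → Kˣ => ((t i)⁻¹ : K)) ∈ torusFunctions K n :=
      Algebra.subset_adjoin (Or.inr ⟨i, rfl⟩)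
    convert pow_mem inv_coord_mem (k + 1) using 1
    ext t
    simp [zpow_negSucc]

theorem character_mem_torusFunctions (m : Fin n → ℤ) :
    (fun t => (character m t : K)) ∈ torusFunctions K n := by
  convert prod_mem fun i (_ : i ∈ Finset.univ) => coe_zpow_mem_torusFunctions (K := K) i (m i)
    using 1
  ext t
  simp [character]

theorem monoidHom_eq_character (F : Multiplicative (Fin n → ℤ) →* Kˣ) (m : Fin n → ℤ) :
    F (.ofAdd m) = character m fun i => F (.ofAdd (Pi.single i 1)) := by
  conv_lhs => rw [pi_eq_sum_univ' m, ofAdd_sum, map_prod]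
  refine Finset.prod_congr rfl fun i _ => ?_
  rw [← map_zpow, ← ofAdd_zsmul]

/-- Lattice points in the interior of the cone spanned by a semigroup `P` of full rank: adding a
multiple of `m₀` moves every lattice point into `P`. -/
def IsInteriorPoint (P : AddSubmonoid (Fin n → ℤ)) (m₀ : Fin n → ℤ) : Prop :=
  m₀ ∈ P ∧ ∀ m, ∃ k : ℕ, m + k • m₀ ∈ P

namespace IsInteriorPoint

variable {P : AddSubmonoid (Fin n → ℤ)} {m₀ : Fin n → ℤ}

theorem map_ne_zero (h : IsInteriorPoint P m₀) {f : Multiplicative P →* K}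
    (hf : f (.ofAdd ⟨m₀, h.1⟩) ≠ 0) (m : P) : f (.ofAdd m) ≠ 0 := by
  obtain ⟨k, hk⟩ := h.2 (-m)
  have hmul : Multiplicative.ofAdd m * .ofAdd ⟨_, hk⟩ = .ofAdd (⟨m₀, h.1⟩ : P) ^ k := by
    rw [← ofAdd_add, ← ofAdd_nsmul]
    exact congrArg _ (Subtype.ext (by simp))
  refine left_ne_zero_of_mul (b := f (.ofAdd ⟨_, hk⟩)) ?_
  rw [← map_mul, hmul, map_pow]
  exact pow_ne_zero k hf

theorem exists_eq_character (h : IsInteriorPoint P m₀) {f : Multiplicative P →* K}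
    (hf : f (.ofAdd ⟨m₀, h.1⟩) ≠ 0) :
    ∃ t : Fin n → Kˣ, ∀ m : P, f (.ofAdd m) = (character m.1 t : K) := by
  let u : P → Kˣ := fun m => Units.mk0 _ (h.map_ne_zero hf m)
  have u_add (a b : P) : u (a + b) = u a * u b := Units.ext (map_mul f _ _)
  have u_nsmul (j : ℕ) : u (j • ⟨m₀, h.1⟩) = u ⟨m₀, h.1⟩ ^ j := Units.ext (map_pow f _ j)
  choose k hk using h.2
  let F : (Fin n → ℤ) → Kˣ := fun m => u ⟨_, hk m⟩ / u ⟨m₀, h.1⟩ ^ k m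
  have u_eq (a : P) (m : Fin n → ℤ) (j : ℕ) (ha : (a : Fin n → ℤ) = m + j • m₀) :
      u a = F m * u ⟨m₀, h.1⟩ ^ j := by
    have hsum : a + k m • ⟨m₀, h.1⟩ = ⟨_, hk m⟩ + j • ⟨m₀, h.1⟩ := Subtype.ext <| by
      simp only [AddSubmonoid.coe_add, AddSubmonoidClass.coe_nsmul, ha]
      abel
    have := congrArg u hsum
    rw [u_add, u_add, u_nsmul, u_nsmul] at this
    rw [div_mul_eq_mul_div, ← this, mul_div_cancel_right]
  have F_add (m m' : Fin n → ℤ) : F (m + m') = F m * F m' := by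
    have := u_eq (⟨_, hk m⟩ + ⟨_, hk m'⟩) (m + m') (k m + k m') (by
      simp only [AddSubmonoid.coe_add, add_smul]
      abel)
    rw [u_add, u_eq ⟨_, hk m⟩ m _ rfl, u_eq ⟨_, hk m'⟩ m' _ rfl, mul_mul_mul_comm,
      ← pow_add] at this
    exact (mul_right_cancel this).symm
  let F' : Multiplicative (Fin n → ℤ) →* Kˣ := MonoidHom.mk' (fun m => F m.toAdd) F_add
  refine ⟨fun i => F' (.ofAdd (Pi.single i 1)), fun m => ?_⟩
  rw [← monoidHom_eq_character F' m.1]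
  exact congrArg Units.val ((u_eq m m 0 (by simp)).trans (by rw [pow_zero, mul_one]; rfl))

theorem eq_zero_of_mem_of_neg_mem {σ : PointedCone ℚ (Fin n → ℚ)}
    (h : IsInteriorPoint (dualMonoid σ) m₀) {w : Fin n → ℚ} (hw : w ∈ σ) (hw' : -w ∈ σ) :
    w = 0 := by
  have pairing_eq_zero (m : Fin n → ℤ) (hm : m ∈ dualMonoid σ) : ∑ i, (m i : ℚ) * w i = 0 := by
    refine le_antisymm ?_ (hm w hw)
    simpa using hm (-w) hw'
  ext i
  obtain ⟨k, hk⟩ := h.2 (Pi.single i 1)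
  have := pairing_eq_zero _ hk
  simpa [add_mul, Finset.sum_add_distrib, Pi.single_apply, mul_assoc, ← Finset.mul_sum,
    pairing_eq_zero m₀ h.1] using this

end IsInteriorPoint

variable {P : AddSubmonoid (Fin n → ℤ)} {A : Type*} [CommRing A] [Algebra K A]
  (e : AddMonoidAlgebra K P ≃ₐ[K] A)

include e in
theorem algHom_ext_of_single {B : Type*} [CommRing B] [Algebra K B] {φ ψ : A →ₐ[K] B}
    (h : ∀ m, φ (e (.single m 1)) = ψ (e (.single m 1))) : φ = ψ := by
  have : φ.comp e.toAlgHom = ψ.comp e.toAlgHom :=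
    AddMonoidAlgebra.algHom_ext h (Subsingleton.elim _ _)
  ext f
  simpa using DFunLike.congr_fun this (e.symm f)

/-- The comorphism of the action of `t` on the variety with coordinate ring `A ≅ K[P]`: it scales
the basis element of `m` by `χ^m(t)`. -/
noncomputable def charScale (t : Fin n → Kˣ) : A →ₐ[K] A :=
  (AddMonoidAlgebra.lift K A P
    { toFun := fun m => (character m.toAdd.1 t : K) • e (.single m.toAdd 1)
      map_one' := by simp [← AddMonoidAlgebra.one_def]
      map_mul' := fun a b => by
        simp [character_add, ← map_mul, AddMonoidAlgebra.single_mul_single, smul_smul,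
          mul_comm] }).comp e.symm.toAlgHom

theorem charScale_single (t : Fin n → Kˣ) (m : P) :
    charScale e t (e (.single m 1)) = (character m.1 t : K) • e (.single m 1) := by
  simp [charScale]

theorem charScale_mul (s t : Fin n → Kˣ) :
    charScale e (s * t) = (charScale e s).comp (charScale e t) :=
  algHom_ext_of_single e fun m => by
    simp [charScale_single, character_mul, smul_smul, mul_comm]

theorem charScale_one : charScale e 1 = AlgHom.id K A :=
  algHom_ext_of_single e fun m => by simp [charScale_single]

theorem exists_charScale_expansion (f : A) :
    ∃ (k : ℕ) (φ : Fin k → torusFunctions K n) (a : Fin k → A),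
      ∀ (t : Fin n → Kˣ) (x : Pts K A),
        x (charScale e t f) = ∑ i, (φ i : (Fin n → Kˣ) → K) t * x (a i) := by
  obtain ⟨f, rfl⟩ := e.surjective f
  induction f using AddMonoidAlgebra.induction_linear with
  | zero => exact ⟨0, Fin.elim0, Fin.elim0, by simp⟩
  | add f g hf hg =>
    obtain ⟨k, φ, a, h⟩ := hf
    obtain ⟨k', φ', a', h'⟩ := hg
    refine ⟨k + k', Fin.append φ φ', Fin.append a a', fun t x => ?_⟩
    simp [Fin.sum_univ_add, h, h']
  | single m r =>
    refine ⟨1, fun _ => ⟨_, character_mem_torusFunctions m.1⟩, fun _ => e (.single m r),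
      fun t x => ?_⟩
    have hr : e (.single m r) = r • e (.single m 1) := by
      rw [← map_smul, AddMonoidAlgebra.smul_single, smul_eq_mul, mul_one]
    simp [hr, charScale_single, mul_left_comm]

/-- The torus action on a variety whose coordinate ring is a semigroup algebra. -/
noncomputable def torusAction : RegularAction (torusFunctions K n) A where
  act :=
    { toFun := fun t =>
        { toFun := fun x => x.comp (charScale e t)
          invFun := fun x => x.comp (charScale e t⁻¹)
          left_inv := fun x => by simp [AlgHom.comp_assoc, ← charScale_mul, charScale_one]
          right_inv := fun x => by simp [AlgHom.comp_assoc, ← charScale_mul, charScale_one] }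
      map_one' := by
        ext x f
        simp [charScale_one]
      map_mul' := fun s t => by
        ext x f
        simp [mul_comm s t, charScale_mul] }
  regular := exists_charScale_expansion e

theorem torusAction_single (m : P) (t : Fin n → Kˣ) (x : Pts K A) :
    (torusAction e).act t x (e (.single m 1)) = (character m.1 t : K) * x (e (.single m 1)) := by
  change x (charScale e t _) = _
  rw [charScale_single, map_smul, smul_eq_mul]

theorem IsInteriorPoint.torusAction_locallyTransitive {m₀ : Fin n → ℤ}
    (h : IsInteriorPoint P m₀) : (torusAction e).LocallyTransitive := by
  let x₀ : Pts K A := (AddMonoidAlgebra.lift K K P 1).comp e.symm.toAlgHom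
  have act_x₀ (t : Fin n → Kˣ) (m : P) :
      (torusAction e).act t x₀ (e (.single m 1)) = (character m.1 t : K) := by
    rw [torusAction_single]
    simp [x₀]
  refine ⟨x₀, {e (.single ⟨m₀, h.1⟩ 1)}, ?_⟩
  ext x
  simp only [Set.mem_singleton_iff, exists_eq_left]
  constructor
  · rintro ⟨t, rfl⟩
    exact (act_x₀ t _).trans_ne (Units.ne_zero _)
  · intro hx
    let f : Multiplicative P →* K :=
      (x.comp e.toAlgHom : AddMonoidAlgebra K P →* K).comp (AddMonoidAlgebra.of K P)
    obtain ⟨t, ht⟩ := h.exists_eq_character (f := f) hx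
    exact ⟨t, algHom_ext_of_single e fun m => (act_x₀ t m).trans (ht m).symm⟩

theorem IsInteriorPoint.isToricWithCone_torusAction {σ : PointedCone ℚ (Fin n → ℚ)}
    {m₀ : Fin n → ℤ} (h : IsInteriorPoint (dualMonoid σ) m₀) (hσ : σ.FG)
    (e : AddMonoidAlgebra K (dualMonoid σ) ≃ₐ[K] A) : IsToricWithCone (torusAction e) σ :=
  ⟨h.torusAction_locallyTransitive e, hσ, fun _ => h.eq_zero_of_mem_of_neg_mem, e,
    torusAction_single e⟩

end Torus

theorem mem_dualMonoid_hull {n : ℕ} {S : Set (Fin n → ℚ)} {m : Fin n → ℤ} :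
    m ∈ dualMonoid (PointedCone.hull ℚ S) ↔ ∀ w ∈ S, 0 ≤ ∑ i, (m i : ℚ) * w i := by
  refine ⟨fun h w hw => h w (Submodule.subset_span hw), fun h w hw => ?_⟩
  induction hw using Submodule.span_induction with
  | mem w hw => exact h w hw
  | zero => simp
  | add v w _ _ hv hw =>
    simp only [Pi.add_apply, mul_add, Finset.sum_add_distrib]
    exact add_nonneg hv hw
  | smul c w _ hw =>
    have : ∑ i, (m i : ℚ) * (c • w) i = c * ∑ i, (m i : ℚ) * w i := by
      simp only [Finset.mul_sum, mul_left_comm (c : ℚ)]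
      rfl
    exact this ▸ mul_nonneg c.2 hw

section Cone

/-- The cone of the toric variety, for the parameters `s = lq` and `t = lp`. -/
def sl2Cone (s t : ℚ) : PointedCone ℚ (Fin 3 → ℚ) :=
  PointedCone.hull ℚ {![1, 0, 0], ![0, 1, 0], ![-1, 0, s], ![0, -1, t]}

theorem sl2Cone_fg (s t : ℚ) : (sl2Cone s t).FG :=
  Submodule.fg_span (by simp)

variable {s t : ℕ}

theorem mem_dualMonoid_sl2Cone {m : Fin 3 → ℤ} :
    m ∈ dualMonoid (sl2Cone s t) ↔ 0 ≤ m 0 ∧ 0 ≤ m 1 ∧ m 0 ≤ s * m 2 ∧ m 1 ≤ t * m 2 := by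
  simp only [sl2Cone, mem_dualMonoid_hull, Set.forall_mem_insert, Set.mem_singleton_iff, forall_eq,
    Fin.sum_univ_three, Matrix.cons_val, mul_zero, mul_one, mul_neg, add_zero, zero_add,
    neg_add_eq_sub, sub_nonneg, mul_comm (m 2 : ℚ), zero_mul]
  norm_cast

theorem mem_dualMonoid_sl2Cone_iff_exists (hs : 0 < s) {m : Fin 3 → ℤ} :
    m ∈ dualMonoid (sl2Cone s t) ↔
      ∃ a b c d z : ℕ, a + c = s * z ∧ b + d = t * z ∧ m = ![(a : ℤ), b, z] := by
  rw [mem_dualMonoid_sl2Cone]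
  constructor
  · rintro ⟨h₀, h₁, h₀', h₁'⟩
    have h₂ : 0 ≤ m 2 := nonneg_of_mul_nonneg_right (h₀.trans h₀') (by exact_mod_cast hs)
    refine ⟨(m 0).toNat, (m 1).toNat, (s * m 2 - m 0).toNat, (t * m 2 - m 1).toNat,
      (m 2).toNat, ?_, ?_, ?_⟩
    · zify
      simp [h₀, h₂, h₀']
    · zify
      simp [h₁, h₂, h₁']
    · ext i
      fin_cases i <;> simp [h₀, h₁, h₂]
  · rintro ⟨a, b, c, d, z, hac, hbd, rfl⟩
    simp only [Matrix.cons_val]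
    norm_cast
    omega

theorem isInteriorPoint_sl2Cone (hs : 0 < s) (ht : 0 < t) :
    IsInteriorPoint (dualMonoid (sl2Cone s t)) ![1, 1, 2] := by
  simp only [IsInteriorPoint, mem_dualMonoid_sl2Cone]
  refine ⟨by simp only [Matrix.cons_val]; omega, fun m => ?_⟩
  refine ⟨(|m 0| + |m 1| + (s + t) * |m 2|).toNat, ?_⟩
  have hk : 0 ≤ |m 0| + |m 1| + (s + t) * |m 2| := by positivity
  have h₂ := neg_abs_le (m 2)
  have h₀ := abs_le.mp (le_refl |m 0|)
  have h₁ := abs_le.mp (le_refl |m 1|)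
  have : 0 ≤ (s : ℤ) * |m 2| := by positivity
  have : 0 ≤ (t : ℤ) * |m 2| := by positivity
  simp only [Matrix.smul_cons, Int.nsmul_eq_mul, Int.ofNat_toNat, hk, sup_of_le_left, mul_one,
    Matrix.smul_empty, Pi.add_apply, Matrix.cons_val]
  refine ⟨?_, ?_, ?_, ?_⟩ <;> nlinarith

end Cone

section ConeMonomials

variable {K : Type*} [Field K] {s t : ℕ}

/-- The function on `SL(2)` that corresponds to a lattice point `m` of the dual cone: the character
`χ^m` in the torus coordinates `α / γ`, `β / δ` and `γ ^ s * δ ^ t`. -/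
def coneMonomial (K : Type*) [Field K] (s t : ℕ) (m : Fin 3 → ℤ) : SL(2, K) → K :=
  entryMonomial (m 0).toNat (m 1).toNat (s * m 2 - m 0).toNat (t * m 2 - m 1).toNat

theorem coneMonomial_eq_entryMonomial {a b c d z : ℕ} (hac : a + c = s * z)
    (hbd : b + d = t * z) : coneMonomial K s t ![(a : ℤ), b, z] = entryMonomial a b c d := by
  have hc : (s * z - a : ℤ) = c := by zify at hac; omega
  have hd : (t * z - b : ℤ) = d := by zify at hbd; omega
  simp [coneMonomial, hc, hd]

theorem coneMonomial_add {m m' : Fin 3 → ℤ} (hm : m ∈ dualMonoid (sl2Cone s t))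
    (hm' : m' ∈ dualMonoid (sl2Cone s t)) :
    coneMonomial K s t (m + m') = coneMonomial K s t m * coneMonomial K s t m' := by
  rw [mem_dualMonoid_sl2Cone] at hm hm'
  rw [coneMonomial, coneMonomial, coneMonomial, entryMonomial_mul_entryMonomial]
  simp only [Pi.add_apply, mul_add]
  congr 1 <;> omega

theorem coneMonomial_zero : coneMonomial K s t 0 = 1 := by
  ext g
  simp [coneMonomial, entryMonomial_apply]

/-- The homomorphism from the semigroup algebra of the cone to functions on `SL(2)` that takes the
basis element of `m` to the corresponding monomial. -/
noncomputable def coneHom (K : Type*) [Field K] (s t : ℕ) :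
    AddMonoidAlgebra K (dualMonoid (sl2Cone s t)) →ₐ[K] (SL(2, K) → K) :=
  AddMonoidAlgebra.lift K _ _
    { toFun := fun m => coneMonomial K s t m.toAdd.1
      map_one' := coneMonomial_zero
      map_mul' := fun a b => coneMonomial_add a.toAdd.2 b.toAdd.2 }

theorem coneHom_apply (f : AddMonoidAlgebra K (dualMonoid (sl2Cone s t))) :
    coneHom K s t f = Finsupp.linearCombination K
      (fun m : dualMonoid (sl2Cone s t) => coneMonomial K s t m.1) f.coeff :=
  AddMonoidAlgebra.lift_apply _ _

theorem mem_range_coneHom (hs : 0 < s) {F : SL(2, K) → K} :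
    F ∈ Set.range (coneHom K s t) ↔
      F ∈ bidegreeSpan K (Set.range fun z => (s * z, t * z)) := by
  have range_eq : bidegreeSpan K (Set.range fun z => (s * z, t * z)) =
      Submodule.span K (Set.range fun m : dualMonoid (sl2Cone s t) => coneMonomial K s t m.1) := by
    refine congrArg (Submodule.span K) (Set.ext fun F => ?_)
    simp only [Set.mem_ofPred_eq, Set.mem_range, Subtype.exists, Prod.mk.injEq,
      mem_dualMonoid_sl2Cone_iff_exists hs]
    constructor
    · rintro ⟨a, b, c, d, ⟨z, hac, hbd⟩, rfl⟩
      exact ⟨_, ⟨a, b, c, d, z, hac.symm, hbd.symm, rfl⟩,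
        coneMonomial_eq_entryMonomial hac.symm hbd.symm⟩
    · rintro ⟨_, ⟨a, b, c, d, z, hac, hbd, rfl⟩, rfl⟩
      exact ⟨a, b, c, d, ⟨z, hac.symm, hbd.symm⟩, coneMonomial_eq_entryMonomial hac hbd⟩
  rw [range_eq, ← Finsupp.range_linearCombination]
  simp only [Set.mem_range, LinearMap.mem_range, coneHom_apply]
  exact ⟨fun ⟨f, hf⟩ => ⟨_, hf⟩, fun ⟨c, hc⟩ => ⟨.ofCoeff c, hc⟩⟩

variable [IsAlgClosed K]

theorem exists_second_row_eq {r t : ℕ} (hr : 0 < r) {x y : K} (hx : x ≠ 0) (hy : y ≠ 0) :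
    ∃ γ δ : K, γ * δ * y = 1 ∧ γ ^ (t + r) * δ ^ t = x := by
  obtain ⟨γ, hγ⟩ := IsAlgClosed.exists_pow_nat_eq (x * y ^ t) hr
  have hγ0 : γ ≠ 0 := by
    rintro rfl
    rw [zero_pow hr.ne'] at hγ
    exact mul_ne_zero hx (pow_ne_zero t hy) hγ.symm
  obtain ⟨δ, hδ⟩ : ∃ δ, γ * δ * y = 1 := ⟨(γ * y)⁻¹, by field_simp⟩
  refine ⟨γ, δ, hδ, ?_⟩
  calc γ ^ (t + r) * δ ^ t = γ ^ r * (γ * δ) ^ t := by ring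
    _ = x * (γ * δ * y) ^ t := by rw [hγ, mul_pow _ y, mul_assoc, mul_comm (y ^ t)]
    _ = x := by rw [hδ, one_pow, mul_one]

theorem exists_coneMonomial_eq (hst : t < s) {τ : Fin 3 → K} (h₂ : τ 2 ≠ 0) (h : τ 0 - τ 1 ≠ 0) :
    ∃ g : SL(2, K), ∀ m ∈ dualMonoid (sl2Cone s t),
      coneMonomial K s t m g = ∏ i, τ i ^ (m i).toNat := by
  obtain ⟨r, rfl⟩ := Nat.exists_eq_add_of_lt hst
  obtain ⟨γ, δ, hdet, hτ⟩ := exists_second_row_eq (t := t) r.succ_pos h₂ h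
  let g : SL(2, K) := ⟨!![γ * τ 0, δ * τ 1; γ, δ], by
    rw [Matrix.det_fin_two_of]
    linear_combination hdet⟩
  refine ⟨g, fun m hm => ?_⟩
  obtain ⟨a, b, c, d, z, hac, hbd, rfl⟩ :=
    (mem_dualMonoid_sl2Cone_iff_exists (Nat.zero_lt_of_lt hst)).mp hm
  have hz : γ ^ (a + c) * δ ^ (b + d) = τ 2 ^ z := by
    rw [hac, hbd, pow_mul, pow_mul, ← mul_pow]
    exact congrArg (· ^ z) hτ
  calc coneMonomial K _ t ![(a : ℤ), b, z] g
      = (γ * τ 0) ^ a * (δ * τ 1) ^ b * γ ^ c * δ ^ d :=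
        congrFun (coneMonomial_eq_entryMonomial hac hbd) g
    _ = τ 0 ^ a * τ 1 ^ b * (γ ^ (a + c) * δ ^ (b + d)) := by ring
    _ = _ := by simp [Fin.prod_univ_three, hz]

theorem coneHom_injective (hst : t < s) : Function.Injective (coneHom K s t) := by
  have : Infinite K := IsAlgClosed.instInfinite
  have independent : LinearIndependent K
      fun m : dualMonoid (sl2Cone s t) => coneMonomial K s t m.1 := by
    refine linearIndependent_of_forall_exists_eq_prod_pow
      (q := MvPolynomial.X 2 * (MvPolynomial.X 0 - MvPolynomial.X 1))
      (mul_ne_zero (MvPolynomial.X_ne_zero _) (sub_ne_zero.mpr ?_))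
      (e := fun m i => (m.1 i).toNat) ?_ fun τ hτ => ?_
    · exact MvPolynomial.X_injective.ne (by decide)
    · intro m m' h
      have hs : 0 < s := Nat.zero_lt_of_lt hst
      obtain ⟨a, b, c, d, z, -, -, hm⟩ := (mem_dualMonoid_sl2Cone_iff_exists hs).mp m.2
      obtain ⟨a', b', c', d', z', -, -, hm'⟩ := (mem_dualMonoid_sl2Cone_iff_exists hs).mp m'.2
      simpa [← Subtype.coe_inj, hm, hm', funext_iff, Fin.forall_fin_succ] using h
    · simp only [map_mul, map_sub, MvPolynomial.eval_X, mul_ne_zero_iff] at hτ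
      obtain ⟨g, hg⟩ := exists_coneMonomial_eq hst hτ.1 hτ.2
      exact ⟨g, fun m => hg m.1 m.2⟩
  intro f f' h
  rw [coneHom_apply, coneHom_apply] at h
  exact AddMonoidAlgebra.coeff_injective (independent h)

end ConeMonomials

theorem mem_of_mem_sup_of_map_eq {K V : Type*} [Field K] [AddCommGroup V] [Module K V]
    {T : Module.End K V} {S S' : Submodule K V} (hS : S ≤ T.eigenspace 1)
    (hS' : S' ≤ ⨆ μ ≠ 1, T.eigenspace μ) {x : V} (hx : x ∈ S ⊔ S') (hTx : T x = x) : x ∈ S := by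
  obtain ⟨y, hy, z, hz, rfl⟩ := Submodule.mem_sup.mp hx
  have hTz : z ∈ T.eigenspace 1 := by
    have hyz : y + z ∈ T.eigenspace 1 := Module.End.mem_eigenspace_iff.mpr (by rw [hTx, one_smul])
    exact (add_mem_cancel_left (hS hy)).mp hyz
  have hz0 : z = 0 := Submodule.disjoint_def.mp (T.eigenspaces_iSupIndep 1) z hTz (hS' hz)
  rwa [hz0, add_zero]

section DiagonalInvariants

variable {K : Type*} [Field K]

/-- The embedding of the multiplicative group as the diagonal matrices of `SL(2)`. -/
def diagHom (K : Type*) [Field K] : Kˣ →* SL(2, K) where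
  toFun ζ := ⟨!![(ζ : K), 0; 0, (ζ⁻¹ : Kˣ)], by simp⟩
  map_one' := by
    ext i j
    fin_cases i <;> fin_cases j <;> simp
  map_mul' a b := Subtype.ext <| by
    change !![((a * b : Kˣ) : K), 0; 0, ((a * b)⁻¹ : Kˣ)] =
      !![(a : K), 0; 0, (a⁻¹ : Kˣ)] * !![(b : K), 0; 0, (b⁻¹ : Kˣ)]
    simp [mul_comm]

@[simp] theorem diagHom_zero_zero (ζ : Kˣ) : (diagHom K ζ).1 0 0 = ζ := rfl
@[simp] theorem diagHom_zero_one (ζ : Kˣ) : (diagHom K ζ).1 0 1 = 0 := rfl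
@[simp] theorem diagHom_one_zero (ζ : Kˣ) : (diagHom K ζ).1 1 0 = 0 := rfl
@[simp] theorem diagHom_one_one (ζ : Kˣ) : (diagHom K ζ).1 1 1 = (ζ⁻¹ : Kˣ) := rfl

theorem diagHom_injective : Function.Injective (diagHom K) := fun _ _ h =>
  Units.ext (congrArg (fun g : SL(2, K) => g.1 0 0) h)

theorem rightTranslate_diagHom_entryMonomial (ζ : Kˣ) (a b c d : ℕ) :
    rightTranslate (diagHom K ζ) (entryMonomial a b c d) =
      ((ζ ^ (a + c) / ζ ^ (b + d) : Kˣ) : K) • (entryMonomial a b c d : SL(2, K) → K) := by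
  ext g
  simp only [rightTranslate_apply, Pi.smul_apply, smul_eq_mul, entryMonomial_apply, sl2_mul_apply,
    diagHom_zero_zero, diagHom_zero_one, diagHom_one_zero, diagHom_one_one, mul_zero, add_zero,
    zero_add, div_eq_mul_inv, ← inv_pow]
  push_cast
  ring

theorem rightTranslate_diagHom_eq_of_mem {ζ : Kˣ} {E : Set (ℕ × ℕ)}
    (hE : ∀ ij ∈ E, ζ ^ ij.1 = ζ ^ ij.2) {F : SL(2, K) → K} (hF : F ∈ bidegreeSpan K E) :
    rightTranslate (diagHom K ζ) F = F := by
  have le_eqLocus : bidegreeSpan K E ≤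
      LinearMap.eqLocus (rightTranslate (diagHom K ζ)).toLinearMap LinearMap.id := by
    refine degreeSpan_le.mpr fun a b c d h => ?_
    refine (rightTranslate_diagHom_entryMonomial ζ a b c d).trans ?_
    rw [div_eq_one.mpr (hE _ h), Units.val_one, one_smul, LinearMap.id_apply]
  exact le_eqLocus hF

theorem mem_bidegreeSpan_of_rightTranslate_diagHom_eq {ζ : Kˣ} {E : Set (ℕ × ℕ)}
    {F : SL(2, K) → K} (hF : F ∈ bidegreeSpan K E) (hinv : rightTranslate (diagHom K ζ) F = F) :
    F ∈ bidegreeSpan K {ij ∈ E | ζ ^ ij.1 = ζ ^ ij.2} := by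
  refine mem_of_mem_sup_of_map_eq (T := (rightTranslate (diagHom K ζ)).toLinearMap)
    (S' := bidegreeSpan K {ij ∈ E | ζ ^ ij.1 ≠ ζ ^ ij.2}) (fun F hF => ?_) ?_ ?_ hinv
  · rw [Module.End.mem_eigenspace_iff, one_smul]
    exact rightTranslate_diagHom_eq_of_mem (fun _ h => h.2) hF
  · refine degreeSpan_le.mpr fun a b c d h => ?_
    refine Submodule.mem_iSup_of_mem ((ζ ^ (a + c) / ζ ^ (b + d) : Kˣ) : K)
      (Submodule.mem_iSup_of_mem ?_ (Module.End.mem_eigenspace_iff.mpr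
        (rightTranslate_diagHom_entryMonomial ζ a b c d)))
    rw [← Units.val_one, Units.val_inj.ne]
    exact div_ne_one.mpr h.2
  · refine degreeSpan_le.mpr (fun a b c d h => ?_) hF
    by_cases hω : ζ ^ (a + c) = ζ ^ (b + d)
    · exact Submodule.mem_sup_left (entryMonomial_mem_degreeSpan ⟨h, hω⟩)
    · exact Submodule.mem_sup_right (entryMonomial_mem_degreeSpan ⟨h, hω⟩)

-- Multiplying a monomial by `det ^ k = 1` raises both column degrees by `k`.
theorem bidegreeSpan_le_of_forall_exists_add_mem {E E' : Set (ℕ × ℕ)}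
    (h : ∀ ij ∈ E, ∃ k, ij + (k, k) ∈ E') : bidegreeSpan K E ≤ bidegreeSpan K E' := by
  have mem_of_add_mem (k : ℕ) : ∀ a b c d : ℕ, (a + c + k, b + d + k) ∈ E' →
      (entryMonomial a b c d : SL(2, K) → K) ∈ bidegreeSpan K E' := by
    induction k with
    | zero => exact fun a b c d h => entryMonomial_mem_degreeSpan h
    | succ k ih =>
      intro a b c d h
      rw [← entryMonomial_succ_sub_entryMonomial_succ]
      refine sub_mem (ih _ _ _ _ ?_) (ih _ _ _ _ ?_) <;> convert h using 2 <;> ring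
  refine degreeSpan_le.mpr fun a b c d hE => ?_
  obtain ⟨k, hk⟩ := h _ hE
  exact mem_of_add_mem k a b c d hk

/-- The exponents `(i, j)` of the monomials of height `j / i` at most `t / s`. -/
def heightSet (t s : ℕ) : Set (ℕ × ℕ) := {ij | s * ij.2 ≤ t * ij.1}

theorem exists_eq_add_mul_of_mem_heightSet {s t : ℕ} (hst : t < s) {ζ : Kˣ}
    (hζ : IsPrimitiveRoot ζ (s - t)) {i j : ℕ} (hij : (i, j) ∈ heightSet t s)
    (hω : ζ ^ i = ζ ^ j) : ∃ z k, i + k = s * z ∧ j + k = t * z := by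
  obtain ⟨r, rfl⟩ := Nat.exists_eq_add_of_lt hst
  rw [show t + r + 1 - t = r + 1 by omega] at hζ
  simp only [heightSet, Set.mem_ofPred_eq] at hij
  have hji : j ≤ i := by
    by_contra! hlt
    nlinarith
  obtain ⟨n, rfl⟩ := Nat.exists_eq_add_of_le hji
  obtain ⟨z, rfl⟩ := hζ.dvd_of_pow_eq_one n (by rwa [pow_add, mul_eq_left] at hω)
  have hjz : j ≤ t * z := by
    have : (r + 1) * j ≤ (r + 1) * (t * z) := by linarith
    exact Nat.le_of_mul_le_mul_left this r.succ_pos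
  obtain ⟨k, hk⟩ := Nat.exists_eq_add_of_le hjz
  exact ⟨z, k, by linear_combination hk.symm, hk.symm⟩

theorem mem_range_coneHom_iff {s t : ℕ} (hst : t < s) {ζ : Kˣ} (hζ : IsPrimitiveRoot ζ (s - t))
    {F : SL(2, K) → K} :
    F ∈ Set.range (coneHom K s t) ↔
      F ∈ bidegreeSpan K (heightSet t s) ∧ rightTranslate (diagHom K ζ) F = F := by
  rw [mem_range_coneHom (Nat.zero_lt_of_lt hst)]
  constructor
  · refine fun hF => ⟨degreeSpan_mono ?_ hF, rightTranslate_diagHom_eq_of_mem ?_ hF⟩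
    · rintro _ _ - ⟨z, ⟨⟩⟩
      exact (mul_left_comm s t z).le
    · rintro _ ⟨z, rfl⟩
      dsimp only
      rw [← Nat.sub_add_cancel hst.le, add_mul, pow_add, pow_mul, hζ.pow_eq_one, one_pow, one_mul]
  · rintro ⟨hF, hinv⟩
    refine bidegreeSpan_le_of_forall_exists_add_mem (fun ij h => ?_)
      (mem_bidegreeSpan_of_rightTranslate_diagHom_eq hF hinv)
    obtain ⟨z, k, hi, hj⟩ := exists_eq_add_mul_of_mem_heightSet hst hζ h.1 h.2
    exact ⟨k, z, Prod.ext hi.symm hj.symm⟩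

end DiagonalInvariants

section UpperTriangular

variable {K : Type*} [Field K]

theorem rightTranslate_upperElem_entryMonomial (s : K) (a b c d : ℕ) :
    rightTranslate (upperElem s) (entryMonomial a b c d) =
      ∑ k ∈ Finset.range (b + 1), ∑ l ∈ Finset.range (d + 1),
        (s ^ k * b.choose k * (s ^ l * d.choose l)) •
          (entryMonomial (a + k) (b - k) (c + l) (d - l) : SL(2, K) → K) := by
  ext g
  simp only [rightTranslate_apply, entryMonomial_apply, sl2_mul_apply, upperElem_zero_zero,
    upperElem_zero_one, upperElem_one_zero, upperElem_one_one, mul_one, mul_zero, add_zero,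
    Finset.sum_apply, Pi.smul_apply, smul_eq_mul]
  rw [mul_assoc, mul_mul_mul_comm, add_pow, add_pow, Finset.sum_mul_sum, Finset.mul_sum]
  refine Finset.sum_congr rfl fun k _ => ?_
  rw [Finset.mul_sum]
  exact Finset.sum_congr rfl fun l _ => by ring

theorem rightTranslate_upperElem_mem {E : Set (ℕ × ℕ)}
    (hE : ∀ i j, (i, j + 1) ∈ E → (i + 1, j) ∈ E) (s : K) {F : SL(2, K) → K}
    (hF : F ∈ bidegreeSpan K E) : rightTranslate (upperElem s) F ∈ bidegreeSpan K E := by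
  have shift_mem (m i j : ℕ) (h : (i, j + m) ∈ E) : (i + m, j) ∈ E := by
    induction m generalizing i with
    | zero => exact h
    | succ m ih =>
      rw [← add_assoc, add_right_comm]
      exact ih (i + 1) (hE _ _ h)
  suffices bidegreeSpan K E ≤
      (bidegreeSpan K E).comap (rightTranslate (upperElem s)).toLinearMap from this hF
  refine degreeSpan_le.mpr fun a b c d h => ?_
  change rightTranslate (upperElem s) (entryMonomial a b c d) ∈ bidegreeSpan K E
  rw [rightTranslate_upperElem_entryMonomial]
  refine sum_mem fun k hk => sum_mem fun l hl =>
    Submodule.smul_mem _ _ (entryMonomial_mem_degreeSpan ?_)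
  rw [Finset.mem_range] at hk hl
  rw [add_add_add_comm]
  exact shift_mem (k + l) _ _ (by convert h using 2; omega)

theorem upperElem_mul_upperElem_neg (s : K) : upperElem s * upperElem (-s) = 1 := by
  ext i j
  rw [sl2_mul_apply]
  fin_cases i <;> fin_cases j <;> simp

theorem rightTranslate_upperElem_mem_iff {E : Set (ℕ × ℕ)}
    (hE : ∀ i j, (i, j + 1) ∈ E → (i + 1, j) ∈ E) (s : K) {F : SL(2, K) → K} :
    rightTranslate (upperElem s) F ∈ bidegreeSpan K E ↔ F ∈ bidegreeSpan K E := by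
  refine ⟨fun h => ?_, rightTranslate_upperElem_mem hE s⟩
  have hF := rightTranslate_upperElem_mem hE (-s) h
  have hinv : upperElem (-s) * upperElem s = 1 := by
    simpa using upperElem_mul_upperElem_neg (-s)
  rwa [rightTranslate_rightTranslate, hinv, rightTranslate_one] at hF

theorem apply_one_zero_eq_zero_of_rightTranslate_mem [Infinite K] {S : Submodule K (SL(2, K) → K)}
    {E : Set (ℕ × ℕ)} (hSE : S ⊓ rowSpan K Set.univ = rowSpan K E) (h10 : (1, 0) ∈ E)
    (h01 : (0, 1) ∉ E) {c : SL(2, K)} (hc : ∀ F ∈ S, rightTranslate c F ∈ S) : c.1 1 0 = 0 := by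
  have htranslate : rightTranslate c (rowMonomial K (1, 0)) =
      Finsupp.linearCombination K (rowMonomial K)
        (.single (1, 0) (c.1 0 0) + .single (0, 1) (c.1 1 0)) := by
    ext g
    simp [rowMonomial_apply, sl2_mul_apply, mul_comm]
  have hrow : rowMonomial K (1, 0) ∈ S := (hSE.ge (rowMonomial_mem_rowSpan h10)).1
  have hsupport := support_subset_of_linearCombination_rowMonomial_mem (K := K)
    (hSE.le ⟨htranslate ▸ hc _ hrow,
      (Finsupp.mem_span_image_iff_linearCombination K).mpr ⟨_, by simp, rfl⟩⟩)
  by_contra hne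
  exact h01 (hsupport (by simp [hne]))

theorem apply_zero_one_eq_zero_of_pow_eq_one [CharZero K] {c : SL(2, K)} (hc : c.1 1 0 = 0)
    (hdiag : c.1 0 0 = c.1 1 1) {r : ℕ} (hr : r ≠ 0) (hcr : c ^ r = 1) : c.1 0 1 = 0 := by
  have hdet : c.1 0 0 * c.1 0 0 = 1 := by simpa [hc, ← hdiag] using sl2_det c
  have entries_pow (n : ℕ) : (c ^ n).1 1 0 = 0 ∧ (c ^ n).1 0 0 = c.1 0 0 ^ n ∧
      c.1 0 0 * (c ^ n).1 0 1 = n * c.1 0 0 ^ n * c.1 0 1 := by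
    induction n with
    | zero => simp
    | succ n ih =>
      obtain ⟨h₁₀, h₀₀, h₀₁⟩ := ih
      rw [pow_succ, sl2_mul_apply, sl2_mul_apply, sl2_mul_apply, hc, h₁₀, h₀₀, ← hdiag]
      refine ⟨by ring, by ring, ?_⟩
      push_cast
      linear_combination c.1 0 0 * h₀₁
  have hr01 : (r : K) * c.1 0 0 ^ r * c.1 0 1 = 0 := by simp [← (entries_pow r).2.2, hcr]
  exact (mul_eq_zero.mp hr01).resolve_left
    (mul_ne_zero (Nat.cast_ne_zero.mpr hr) (pow_ne_zero _ (left_ne_zero_of_mul_eq_one hdet)))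

theorem exists_upperElem_mul_eq_diagHom_mul [CharZero K] {c : SL(2, K)} (hc : c.1 1 0 = 0)
    (hfin : IsOfFinOrder c) :
    ∃ (s : K) (ζ : Kˣ), upperElem s * c = diagHom K ζ * upperElem s := by
  have hdet : c.1 0 0 * c.1 1 1 = 1 := by simpa [hc] using sl2_det c
  have hinv : (c.1 0 0)⁻¹ = c.1 1 1 := inv_eq_of_mul_eq_one_right hdet
  obtain ⟨s, hs⟩ : ∃ s : K, c.1 0 1 + s * c.1 1 1 = c.1 0 0 * s := by
    by_cases hdiag : c.1 0 0 = c.1 1 1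
    · exact ⟨0, by simp [apply_zero_one_eq_zero_of_pow_eq_one hc hdiag hfin.orderOf_pos.ne'
        (pow_orderOf_eq_one c)]⟩
    · have hne : c.1 0 0 - c.1 1 1 ≠ 0 := sub_ne_zero.mpr hdiag
      refine ⟨c.1 0 1 / (c.1 0 0 - c.1 1 1), ?_⟩
      field_simp
      ring
  refine ⟨s, Units.mk0 _ (left_ne_zero_of_mul_eq_one hdet), ?_⟩
  ext i j
  rw [sl2_mul_apply, sl2_mul_apply]
  fin_cases i <;> fin_cases j <;> simp [hc, hs, hinv]

theorem orderOf_eq_of_mul_eq_diagHom_mul {u c : SL(2, K)} {ζ : Kˣ}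
    (h : u * c = diagHom K ζ * u) : orderOf ζ = orderOf c := by
  rw [← orderOf_injective _ diagHom_injective, eq_mul_inv_of_mul_eq h.symm, ← MulAut.conj_apply,
    MulEquiv.orderOf_eq]

theorem leftTranslate_eq_of_mem_rowSpan {u : SL(2, K)} (hu : u ∈ lowerUnipotent K)
    {F : SL(2, K) → K} (hF : F ∈ rowSpan K Set.univ) : leftTranslate u F = F := by
  have le_eqLocus : rowSpan K Set.univ ≤
      LinearMap.eqLocus (leftTranslate u).toLinearMap LinearMap.id := by
    refine rowSpan_le.mpr fun ij _ => funext fun g => ?_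
    simp [rowMonomial_apply, sl2_mul_apply, hu.1, hu.2.1]
  exact le_eqLocus hF

end UpperTriangular

section HeightSet

variable {s t : ℕ}

theorem mem_heightSet_of_succ_succ_mem (hst : t < s) (i j : ℕ)
    (h : (i + 1, j + 1) ∈ heightSet t s) : (i, j) ∈ heightSet t s := by
  change s * (j + 1) ≤ t * (i + 1) at h
  change s * j ≤ t * i
  linarith

theorem succ_mem_heightSet_of_mem_succ (i j : ℕ) (h : (i, j + 1) ∈ heightSet t s) :
    (i + 1, j) ∈ heightSet t s := by
  change s * (j + 1) ≤ t * i at h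
  change s * j ≤ t * (i + 1)
  linarith

theorem image_rowMonomial_heightSet (K : Type*) [Field K] (hs : 0 < s) :
    rowMonomial K '' heightSet t s = {m : SL(2, K) → K | ∃ i j : ℕ, (j : ℚ) ≤ (t : ℚ) / s * i ∧
      m = fun g => g.1 0 0 ^ i * g.1 0 1 ^ j} := by
  have le_iff (i j : ℕ) : (j : ℚ) ≤ (t : ℚ) / s * i ↔ (i, j) ∈ heightSet t s := by
    rw [div_mul_eq_mul_div, le_div_iff₀' (Nat.cast_pos.mpr hs)]
    exact_mod_cast Iff.rfl
  ext m
  simp only [le_iff, Set.mem_image, Prod.exists, Set.mem_ofPred_eq]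
  refine exists₂_congr fun i j => and_congr_right fun _ => eq_comm.trans ?_
  rw [show rowMonomial K (i, j) = _ from funext (rowMonomial_apply (i, j))]

end HeightSet

section Quotients

variable {K A B : Type*} [Field K] [IsAlgClosed K] [CommRing A] [Algebra K A] [CommRing B]
  [IsDomain B] [Algebra K B] [Algebra.FiniteType K B]
  {ρX : RegularAction (sl2Functions K) A} {ρ : RegularAction (sl2Functions K) B}

theorem orbitFunctions_inf_rowSpan {y : Pts K B} (hy : IsZariskiOpen (ρ.orbit y))
    {E : Set (ℕ × ℕ)}
    (h : ρ.orbitMap y '' ρ.invariants (lowerUnipotent K) = (rowSpan K E : Set (SL(2, K) → K))) :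
    ρ.orbitFunctions y ⊓ rowSpan K Set.univ = rowSpan K E := by
  refine le_antisymm ?_ (le_inf (fun F hF => ?_) (Submodule.span_mono (Set.image_mono
    (Set.subset_univ E))))
  · rintro _ ⟨⟨f, rfl⟩, hf⟩
    refine h.le ⟨f, ρ.mem_invariants_of_orbitMap hy fun u hu => ?_, rfl⟩
    exact leftTranslate_eq_of_mem_rowSpan hu hf
  · obtain ⟨f, -, rfl⟩ := h.ge hF
    exact ⟨f, rfl⟩

theorem IsRightQuotient.exists_generator {C : Subgroup SL(2, K)} [IsCyclic C]
    (h : IsRightQuotient ρX ρ C) {y₀ : Pts K B} (hy₀ : IsZariskiOpen (ρ.orbit y₀)) :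
    ∃ c : SL(2, K), orderOf c = Nat.card C ∧
      (∀ F ∈ ρ.orbitFunctions y₀, rightTranslate c F ∈ ρ.orbitFunctions y₀) ∧
      ∃ ι : A →ₐ[K] (SL(2, K) → K), Function.Injective ι ∧
        ∀ F, F ∈ Set.range ι ↔ F ∈ ρ.orbitFunctions y₀ ∧ rightTranslate c F = F := by
  obtain ⟨y, ⟨hy, -⟩, θ, hθ, π, hπ, hrange, -⟩ := h
  obtain ⟨g₀, rfl⟩ := ρ.exists_act_eq hy₀ hy
  obtain ⟨c₀, hc₀⟩ := IsCyclic.exists_generator (α := C)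
  have orbitMap_θ (c : C) (f : B) :
      ρ.orbitMap y₀ (θ c f) = rightTranslate (g₀⁻¹ * c * g₀) (ρ.orbitMap y₀ f) := by
    refine rightTranslate_injective g₀ ?_
    rw [← ρ.orbitMap_act, rightTranslate_rightTranslate, ← mul_assoc, mul_inv_cancel_left,
      ← rightTranslate_rightTranslate, ← ρ.orbitMap_act]
    exact funext fun g => hθ c g f
  have θ_eq_iff (c : C) (f : B) : θ c f = f ↔
      rightTranslate (g₀⁻¹ * c * g₀) (ρ.orbitMap y₀ f) = ρ.orbitMap y₀ f := by
    rw [← orbitMap_θ, (ρ.orbitMap_injective hy₀).eq_iff]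
  refine ⟨g₀⁻¹ * c₀ * g₀, ?_, ?_, (ρ.orbitMap y₀).comp π, (ρ.orbitMap_injective hy₀).comp hπ, ?_⟩
  · rw [← orderOf_eq_card_of_forall_mem_zpowers hc₀, ← Subgroup.orderOf_coe]
    simpa using (MulAut.conj g₀⁻¹).orderOf_eq (c₀ : SL(2, K))
  · rintro _ ⟨f, rfl⟩
    exact ⟨θ c₀ f, orbitMap_θ c₀ f⟩
  · intro F
    constructor
    · rintro ⟨a, rfl⟩
      exact ⟨⟨π a, rfl⟩, (θ_eq_iff c₀ (π a)).mp (hrange.le ⟨a, rfl⟩ c₀)⟩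
    · rintro ⟨⟨f, rfl⟩, hf⟩
      obtain ⟨a, rfl⟩ := (Set.ext_iff.mp hrange f).mpr fun c => by
        refine (θ_eq_iff c f).mpr (rightTranslate_eq_of_mem_zpowers hf ?_)
        obtain ⟨k, rfl⟩ := hc₀ c
        exact ⟨k, by simpa using conj_zpow (i := k) (a := g₀⁻¹) (b := (c₀ : SL(2, K)))⟩
      exact ⟨a, rfl⟩

theorem orbitFunctions_eq_bidegreeSpan_heightSet [CharZero K] {s t : ℕ} (hst : t < s)
    {y : Pts K B} (hy : IsZariskiOpen (ρ.orbit y))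
    (hheight : ρ.orbitMap y '' ρ.invariants (lowerUnipotent K) =
      (rowSpan K (heightSet t s) : Set (SL(2, K) → K))) :
    ρ.orbitFunctions y = bidegreeSpan K (heightSet t s) :=
  eq_bidegreeSpan (ρ.isLeftStable_orbitFunctions y) (ρ.orbitFunctions_le y)
    (mem_heightSet_of_succ_succ_mem hst) (orbitFunctions_inf_rowSpan hy hheight)

theorem HasHeight.nonempty_algEquiv [CharZero K] {s t : ℕ} (hst : t < s)
    (h : HasHeight ρX (s - t) ((t : ℚ) / s)) :
    Nonempty (AddMonoidAlgebra K (dualMonoid (sl2Cone s t)) ≃ₐ[K] A) := by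
  obtain ⟨B, _, _, _, _, _, ρ, C, -, ⟨y, ⟨hy, -⟩, hheight⟩, hcyc, hcard, hquot⟩ := h
  have hs : 0 < s := Nat.zero_lt_of_lt hst
  have hE := succ_mem_heightSet_of_mem_succ (s := s) (t := t)
  rw [← image_rowMonomial_heightSet K hs] at hheight
  obtain ⟨c, horder, hstable, ι, hι, hrange⟩ := hquot.exists_generator hy
  rw [hcard] at horder
  have hc : c.1 1 0 = 0 := apply_one_zero_eq_zero_of_rightTranslate_mem
    (orbitFunctions_inf_rowSpan hy hheight) (by simp [heightSet]) (by simp [heightSet, hs.ne'])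
    hstable
  have hfin : IsOfFinOrder c := orderOf_pos_iff.mp (horder ▸ Nat.sub_pos_of_lt hst)
  obtain ⟨a, ζ, hac⟩ := exists_upperElem_mul_eq_diagHom_mul hc hfin
  have hζ : IsPrimitiveRoot ζ (s - t) := by
    rw [← horder, ← orderOf_eq_of_mul_eq_diagHom_mul hac]
    exact IsPrimitiveRoot.orderOf ζ
  simp only [orbitFunctions_eq_bidegreeSpan_heightSet hst hy hheight] at hrange
  have range_eq : (coneHom K s t).range = ((rightTranslate (upperElem a)).comp ι).range :=
    Subalgebra.ext fun F => (mem_range_coneHom_iff hst hζ).trans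
      (mem_range_rightTranslate_comp_iff (V := bidegreeSpan K (heightSet t s)) hac
        (fun _ => rightTranslate_upperElem_mem_iff hE a) hrange F).symm
  exact ⟨(AlgEquiv.ofInjective _ (coneHom_injective hst)).trans
    ((Subalgebra.equivOfEq _ _ range_eq).trans
      (AlgEquiv.ofInjective ((rightTranslate (upperElem a)).comp ι)
        ((rightTranslate_injective _).comp hι)).symm)⟩

end Quotients

end ToricSL2

theorem proposition8 {K : Type*} [Field K] [IsAlgClosed K] [CharZero K]
    {A : Type*} [CommRing A] [IsDomain A] [IsIntegrallyClosed A] [Algebra K A]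
    [Algebra.FiniteType K A]
    (p q l : ℕ) (hp : 0 < p) (hpq : p < q) (hcop : Nat.Coprime p q) (hl : 0 < l)
    (ρ : RegularAction (sl2Functions K) A)
    (hX : IsSL2ModCyclicEmbedding ρ (l * (q - p)))
    (hh : HasHeight ρ (l * (q - p)) ((p : ℚ) / q)) :
    ∃ τ : RegularAction (torusFunctions K 3) A,
      IsToricWithCone τ (PointedCone.hull ℚ
        {![1, 0, 0], ![0, 1, 0], ![-1, 0, (l : ℚ) * q], ![0, -1, (l : ℚ) * p]}) := by
  have hlpq : l * p < l * q := Nat.mul_lt_mul_of_pos_left hpq hl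
  have hheight : (p : ℚ) / q = (l * p : ℕ) / (l * q : ℕ) := by
    rw [Nat.cast_mul, Nat.cast_mul, mul_div_mul_left _ _ (Nat.cast_ne_zero.mpr hl.ne')]
  rw [Nat.mul_sub, hheight] at hh
  obtain ⟨e⟩ := hh.nonempty_algEquiv hlpq
  have hinterior : IsInteriorPoint (dualMonoid (sl2Cone (l * q : ℕ) (l * p : ℕ))) ![1, 1, 2] :=
    isInteriorPoint_sl2Cone (Nat.zero_lt_of_lt hlpq) (Nat.mul_pos hl hp)
  have hcone : sl2Cone (l * q : ℕ) (l * p : ℕ) = PointedCone.hull ℚ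
      {![1, 0, 0], ![0, 1, 0], ![-1, 0, (l : ℚ) * q], ![0, -1, (l : ℚ) * p]} := by
    rw [sl2Cone, Nat.cast_mul, Nat.cast_mul]
  rw [← hcone]
  exact ⟨torusAction e, hinterior.isToricWithCone_torusAction (sl2Cone_fg _ _) e⟩
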